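/- **Theorem (Breathers near the anticontinuum limit).** Let $V\in C^2(\mathbb R)$ be even, $V(-x)=V(x)$, let $\gamma_{\rm in}\in\mathbb R$, let ${\bf R}$ be a bounded linear operator on $l^2(\mathbb Z;\mathbb R^2)$, and let $T_b>0$, $\omega_b=2\pi/T_b$. Let $H^2_{T_b}$ be the space of even functions in $H^2(\mathbb R/T_b\mathbb Z;\mathbb R^2)$, let $\mathcal H^2_{T_b}$ be the Banach space of sequences $X=(x_n)_{n\in\mathbb Z}$ with $x_n=(x_n^A,x_n^B)^\top\in H^2_{T_b}$ and $\|X\|^2=\sum_{n}\|x_n\|_{H^2}^2<\infty$, and let $\mathcal H^0_{T_b}$ be the analogous space with the even functions of $L^2(\mathbb R/T_b\mathbb Z;\mathbb R^2)$ in place of $H^2_{T_b}$. For $X\in\mathcal H^2_{T_b}$ and $\lambda\in\mathbb R$ define $F(X,\lambda)\in\mathcal H^0_{T_b}$ by $$[F(X,\lambda)]_n=\begin{pmatrix}\ddot x_n^A+V'(x_n^A)-\gamma_{\rm in}x_n^B\\ \ddot x_n^B+V'(x_n^B)-\gamma_{\rm in}x_n^A\end{pmatrix}+\lambda\,[{\bf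 R}X]_n,\qquad n\in\mathbb Z,$$ where ${\bf R}$ acts on $X(t)\in l^2(\mathbb Z;\mathbb R^2)$ for almost every $t$. Let $x_*=(x_*^A,x_*^B)^\top$ be a $T_b$-periodic solution, even in $t$, of the isolated dimer $\ddot x^A=-V'(x^A)+\gamma_{\rm in}x^B$, $\ddot x^B=-V'(x^B)+\gamma_{\rm in}x^A$, and let $X_*\in\mathcal H^2_{T_b}$ be the sequence whose entry at $n=0$ is $x_*$ and whose other entries are $0$. Assume: (a) (Non-resonance) $(n\omega_b)^2\neq V''(0)+\gamma_{\rm in}$ and $(n\omega_b)^2\ne V''(0)-\gamma_{\rm in}$ for all $n\in\mathbb Z$. (b) (Non-degeneracy) The operator $$L_*=\begin{pmatrix}\frac{d^2}{dt^2}+V''(x_*^A(t))&-\gamma_{\rm in}\\-\gamma_{\rm in}&\frac{d^2}{dt^2}+V''(x_*^B(t))\end{pmatrix}$$ acting on $H^2_{T_b}$ has trivial null space $\{0\}$. Then there exist $\lambda_b>0$ and a $C^1$ curve $\lambda\in[0,\lambda_b)\mapsto X^\lambda\in\mathcal H^2_{T_b}$ such that $X^0=X_*$ and $F(X^\lambda,\lambda)=0$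 for all $0\le\lambda<\lambda_b$. -/

import Mathlib

open MeasureTheory
open scoped ENNReal

noncomputable section

namespace DimerArray

/-- The state space `ℝ²` of one dimer, with the Euclidean norm. Coordinate `0` is the amplitude of
the `A` site and coordinate `1` is the amplitude of the `B` site. -/
abbrev Cell : Type := EuclideanSpace ℝ (Fin 2)

/-- The space `ℓ²(ℤ; ℝ²)` of square-summable configurations of the array. -/
abbrev Config : Type := lp (fun _ : ℤ => Cell) 2

section Loops

variable {T : ℝ} {E : Type*}

/-- A `T`-periodic function (that is, a function on `ℝ / Tℤ`) is of class `C^k`. -/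
def LoopContDiff [NormedAddCommGroup E] [NormedSpace ℝ E] (k : ℕ∞) (f : AddCircle T → E) : Prop :=
  ContDiff ℝ k (fun t : ℝ => f (t : AddCircle T))

theorem periodic_deriv_loop [NormedAddCommGroup E] [NormedSpace ℝ E] (f : AddCircle T → E) :
    Function.Periodic (deriv (fun t : ℝ => f (t : AddCircle T))) T := by
  intro t
  rw [← deriv_comp_add_const]
  congr 1
  funext s
  simp

/-- The classical time derivative of a `T`-periodic function, again as a `T`-periodic function. -/
def loopDeriv [NormedAddCommGroup E] [NormedSpace ℝ E] (f : AddCircle T → E) : AddCircle T → E :=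
  (periodic_deriv_loop f).lift

theorem loopDeriv_coe [NormedAddCommGroup E] [NormedSpace ℝ E] (f : AddCircle T → E) (t : ℝ) :
    loopDeriv f (t : AddCircle T) = deriv (fun s : ℝ => f (s : AddCircle T)) t :=
  Function.Periodic.lift_coe _ t

theorem continuous_of_coe [TopologicalSpace E] {f : AddCircle T → E}
    (h : Continuous (fun t : ℝ => f (t : AddCircle T))) : Continuous f :=
  isQuotientMap_quotient_mk'.continuous_iff.2 h

theorem LoopContDiff.continuous [NormedAddCommGroup E] [NormedSpace ℝ E] {k : ℕ∞}
    {f : AddCircle T → E} (h : LoopContDiff k f) : Continuous f :=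
  continuous_of_coe (ContDiff.continuous h)

theorem LoopContDiff.continuous_loopDeriv [NormedAddCommGroup E] [NormedSpace ℝ E] {k : ℕ∞}
    {f : AddCircle T → E} (h : LoopContDiff k f) (hk : 1 ≤ k) : Continuous (loopDeriv f) := by
  apply continuous_of_coe
  simp only [loopDeriv_coe]
  exact ContDiff.continuous_deriv h (by exact_mod_cast hk)

theorem LoopContDiff.loopDeriv_succ [NormedAddCommGroup E] [NormedSpace ℝ E]
    {f : AddCircle T → E} (h : LoopContDiff 2 f) : LoopContDiff 1 (loopDeriv f) := by
  unfold LoopContDiff at *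
  simp only [loopDeriv_coe]
  have h' : ContDiff ℝ (1 + 1) (fun t : ℝ => f (t : AddCircle T)) := by
    convert h using 1
    norm_num
  exact (contDiff_succ_iff_deriv.1 h').2.2

end Loops

variable (T : ℝ) [Fact (0 < T)]

/-- `L²(ℝ / Tℤ; ℝ²)`; the measure on `ℝ / Tℤ` is Lebesgue measure, of total mass `T`. -/
abbrev L2Loop : Type := Lp Cell 2 (volume : Measure (AddCircle T))

variable {T}

/-- `v` is the weak derivative of `u` on `ℝ / Tℤ`. -/
def IsWeakDeriv (u v : L2Loop T) : Prop :=
  ∀ φ : AddCircle T → ℝ, LoopContDiff (⊤ : ℕ∞) φ →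
    ∫ t, loopDeriv φ t • u t = -∫ t, φ t • v t

theorem memLp_top_of_continuous {φ : AddCircle T → ℝ} (hφ : Continuous φ) :
    MemLp φ ∞ (volume : Measure (AddCircle T)) := by
  obtain ⟨C, hC⟩ := isCompact_univ.exists_bound_of_continuousOn hφ.continuousOn
  exact memLp_top_of_bound hφ.aestronglyMeasurable C
    (Filter.Eventually.of_forall fun t => hC t (Set.mem_univ t))

theorem memLp_one_L2Loop (u : L2Loop T) : MemLp (u : AddCircle T → Cell) 1 volume :=
  (Lp.memLp u).mono_exponent (by norm_num)

theorem integrable_smul_L2Loop {φ : AddCircle T → ℝ} (hφ : Continuous φ) (u : L2Loop T) :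
    Integrable (fun t => φ t • u t) volume := by
  have h : MemLp (φ • (u : AddCircle T → Cell)) 1 volume :=
    (memLp_one_L2Loop u).smul (memLp_top_of_continuous hφ)
  exact memLp_one_iff_integrable.1 h

theorem IsWeakDeriv.add {u v u' v' : L2Loop T} (h : IsWeakDeriv u v) (h' : IsWeakDeriv u' v') :
    IsWeakDeriv (u + u') (v + v') := by
  intro φ hφ
  have key : ∀ (ψ : AddCircle T → ℝ) (_ : Continuous ψ) (a b : L2Loop T),
      ∫ t, ψ t • (a + b : L2Loop T) t = (∫ t, ψ t • a t) + ∫ t, ψ t • b t := by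
    intro ψ hψ a b
    rw [← integral_add (integrable_smul_L2Loop hψ a) (integrable_smul_L2Loop hψ b)]
    apply integral_congr_ae
    filter_upwards [Lp.coeFn_add a b] with t ht
    rw [ht, Pi.add_apply, smul_add]
  rw [key _ (hφ.continuous_loopDeriv (by norm_num)), key _ hφ.continuous, h φ hφ, h' φ hφ]
  abel

theorem IsWeakDeriv.smul (c : ℝ) {u v : L2Loop T} (h : IsWeakDeriv u v) :
    IsWeakDeriv (c • u) (c • v) := by
  intro φ hφ
  have key : ∀ (ψ : AddCircle T → ℝ) (a : L2Loop T),
      ∫ t, ψ t • (c • a : L2Loop T) t = c • ∫ t, ψ t • a t := by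
    intro ψ a
    rw [← integral_smul]
    apply integral_congr_ae
    filter_upwards [Lp.coeFn_smul c a] with t ht
    rw [ht, Pi.smul_apply, smul_comm]
  rw [key, key, h φ hφ, smul_neg]

theorem IsWeakDeriv.zero : IsWeakDeriv (0 : L2Loop T) 0 := by
  intro φ _
  have key : ∀ ψ : AddCircle T → ℝ, ∫ t, ψ t • (0 : L2Loop T) t = 0 := by
    intro ψ
    rw [← integral_zero (AddCircle T) Cell]
    apply integral_congr_ae
    filter_upwards [Lp.coeFn_zero Cell 2 (volume : Measure (AddCircle T))] with t ht
    rw [ht, Pi.zero_apply, smul_zero]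
  rw [key, key, neg_zero]

variable (T) in
/-- The Hilbert space of even `H²` functions on `ℝ / Tℤ` with values in `ℝ²`. An element is recorded
as the triple `(x, x', x'')` in `L² × L² × L²` formed by an even function `x` and its first and
second weak derivatives (which `x` determines), so that the induced norm is the `H²` norm
`‖x‖² = ∫ |x|² + |x'|² + |x''|²`. -/
def H2Even : Submodule ℝ (PiLp 2 (fun _ : Fin 3 => L2Loop T)) where
  carrier := {z | IsWeakDeriv (z 0) (z 1) ∧ IsWeakDeriv (z 1) (z 2) ∧
    ∀ᵐ t : AddCircle T, z 0 (-t) = z 0 t}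
  zero_mem' := by
    refine ⟨IsWeakDeriv.zero, IsWeakDeriv.zero, ?_⟩
    have h0 := Lp.coeFn_zero Cell 2 (volume : Measure (AddCircle T))
    have h1 := (Measure.measurePreserving_neg (volume : Measure (AddCircle T))
      ).quasiMeasurePreserving.ae h0
    filter_upwards [h0, h1] with t a b
    exact b.trans a.symm
  add_mem' := by
    rintro z w ⟨hz1, hz2, hz3⟩ ⟨hw1, hw2, hw3⟩
    refine ⟨hz1.add hw1, hz2.add hw2, ?_⟩
    have h0 := Lp.coeFn_add (z 0) (w 0)
    have h1 := (Measure.measurePreserving_neg (volume : Measure (AddCircle T))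
      ).quasiMeasurePreserving.ae h0
    filter_upwards [h0, h1, hz3, hw3] with t a b c d
    change (z 0 + w 0 : L2Loop T) (-t) = (z 0 + w 0 : L2Loop T) t
    rw [a, b, Pi.add_apply, Pi.add_apply, c, d]
  smul_mem' := by
    rintro c z ⟨hz1, hz2, hz3⟩
    refine ⟨hz1.smul c, hz2.smul c, ?_⟩
    have h0 := Lp.coeFn_smul c (z 0)
    have h1 := (Measure.measurePreserving_neg (volume : Measure (AddCircle T))
      ).quasiMeasurePreserving.ae h0
    filter_upwards [h0, h1, hz3] with t a b d
    change (c • z 0 : L2Loop T) (-t) = (c • z 0 : L2Loop T) t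
    rw [a, b, Pi.smul_apply, Pi.smul_apply, d]

/-- The function underlying an element of `H2Even T`. -/
def fn (y : H2Even T) : L2Loop T := y.1 0

/-- The second weak time derivative of an element of `H2Even T`. -/
def secondDeriv (y : H2Even T) : L2Loop T := y.1 2

variable (T) in
/-- The space of square-summable sequences of even `T`-periodic `H²` functions, with norm
`‖X‖² = ∑ₙ ‖xₙ‖²_{H²}`. -/
abbrev BreatherSpace : Type := lp (fun _ : ℤ => H2Even T) 2

/-- The configuration `(xₙ(t))ₙ ∈ ℓ²(ℤ; ℝ²)` of `X` at time `t`. It is square summable for almost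
every `t` (see `snapshot_ae`); at the remaining times the value is irrelevant and set to `0`. -/
def snapshot (X : BreatherSpace T) (t : AddCircle T) : Config :=
  open scoped Classical in
  if h : Memℓp (fun n : ℤ => fn (X n) t) 2 then ⟨fun n => fn (X n) t, h⟩ else 0

theorem norm_fn_le (y : H2Even T) : ‖fn y‖ ≤ ‖y‖ := PiLp.norm_apply_le y.1 0

theorem snapshot_ae (X : BreatherSpace T) :
    ∀ᵐ t : AddCircle T, ∀ n : ℤ, snapshot X t n = fn (X n) t := by
  have hX : Summable fun n : ℤ => ‖X n‖ ^ (2 : ℕ) := by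
    have := (lp.memℓp X).summable (by norm_num)
    simpa using this
  have hX' : Summable fun n : ℤ => ‖fn (X n)‖ ^ (2 : ℕ) :=
    hX.of_nonneg_of_le (fun n => by positivity)
      fun n => pow_le_pow_left₀ (norm_nonneg _) (norm_fn_le _) 2
  have hint : ∀ n : ℤ, ∫⁻ t, ‖fn (X n) t‖ₑ ^ (2 : ℝ) = ENNReal.ofReal (‖fn (X n)‖ ^ (2 : ℕ)) := by
    intro n
    have h1 := eLpNorm_nnreal_pow_eq_lintegral (f := (fn (X n) : AddCircle T → Cell))
      (μ := volume) (p := 2) (by norm_num)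
    have h2 : eLpNorm (fn (X n) : AddCircle T → Cell) 2 volume = ENNReal.ofReal ‖fn (X n)‖ := by
      rw [Lp.norm_def, ENNReal.ofReal_toReal (Lp.eLpNorm_ne_top _)]
    simp only [NNReal.coe_ofNat, ENNReal.coe_ofNat] at h1
    rw [← h1, h2, ENNReal.ofReal_pow (norm_nonneg _)]
    norm_num
  have hfin : ∫⁻ t, ∑' n : ℤ, ‖fn (X n) t‖ₑ ^ (2 : ℝ) ≠ ∞ := by
    rw [lintegral_tsum fun n =>
      ((Lp.aestronglyMeasurable (fn (X n))).enorm.pow_const _)]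
    simp only [hint]
    exact hX'.tsum_ofReal_ne_top
  have hae := ae_lt_top' (AEMeasurable.tsum fun n : ℤ =>
      (Lp.aestronglyMeasurable (fn (X n))).enorm.pow_const (2 : ℝ)) hfin
  filter_upwards [hae] with t ht n
  have hmem : Memℓp (fun n : ℤ => fn (X n) t) 2 := by
    apply memℓp_gen
    have := ENNReal.summable_toReal ht.ne
    refine this.congr fun m => ?_
    rw [← ENNReal.toReal_rpow, toReal_enorm]
    norm_num
  rw [snapshot, dif_pos hmem]

/-- The on-site and in-cell part `(V'(xᴬ) - γ xᴮ, V'(xᴮ) - γ xᴬ)` of the equations of motion. -/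
def onsite (V : ℝ → ℝ) (γ : ℝ) (x : Cell) : Cell :=
  !₂[deriv V (x 0) - γ * x 1, deriv V (x 1) - γ * x 0]

/-- The linearization `(V''(xᴬ) yᴬ - γ yᴮ, V''(xᴮ) yᴮ - γ yᴬ)` of `onsite` at `x`, applied to
`y`. -/
def onsiteLin (V : ℝ → ℝ) (γ : ℝ) (x y : Cell) : Cell :=
  !₂[deriv (deriv V) (x 0) * y 0 - γ * y 1, deriv (deriv V) (x 1) * y 1 - γ * y 0]

/-- `x` is a classical even `T`-periodic solution of the isolated dimer system
`ẍᴬ = -V'(xᴬ) + γ xᴮ`, `ẍᴮ = -V'(xᴮ) + γ xᴬ`. -/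
structure IsDimerOrbit (V : ℝ → ℝ) (γ : ℝ) (x : AddCircle T → Cell) : Prop where
  contDiff : LoopContDiff 2 x
  even : ∀ t, x (-t) = x t
  eq : ∀ t, loopDeriv (loopDeriv x) t + onsite V γ (x t) = 0

/-- `[L_* y](t) = ÿ(t) + (V''(x_*ᴬ(t)) yᴬ(t) - γ yᴮ(t), V''(x_*ᴮ(t)) yᴮ(t) - γ yᴬ(t))`, the
linearized operator of the isolated dimer along `x_*`, acting on even `T`-periodic `H²`
functions. -/
def linearizedDimer (V : ℝ → ℝ) (γ : ℝ) (x : AddCircle T → Cell) (y : H2Even T) :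
    AddCircle T → Cell :=
  fun t => secondDeriv y t + onsiteLin V γ (x t) (fn y t)

/-- The mapping `F`: the component at site `n` of `F(X, lam)` is
`ẍₙ + (V'(xₙᴬ) - γ xₙᴮ, V'(xₙᴮ) - γ xₙᴬ) + lam [R X]ₙ`, where `R` acts on the configuration at
each time. -/
def arrayMap (V : ℝ → ℝ) (γ : ℝ) (R : Config →L[ℝ] Config) (X : BreatherSpace T) (lam : ℝ) (n : ℤ) :
    AddCircle T → Cell :=
  fun t => secondDeriv (X n) t + onsite V γ (fn (X n) t) + lam • R (snapshot X t) n

/-- A continuous loop as an element of `L²`. -/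
def contLoop (f : AddCircle T → Cell) (hf : Continuous f) : L2Loop T :=
  ContinuousMap.toLp 2 volume ℝ ⟨f, hf⟩

theorem contLoop_ae (f : AddCircle T → Cell) (hf : Continuous f) :
    ∀ᵐ t : AddCircle T, contLoop f hf t = f t :=
  ContinuousMap.coeFn_toLp (𝕜 := ℝ) (p := 2) volume ⟨f, hf⟩

theorem isWeakDeriv_contLoop (f : AddCircle T → Cell) (hf : LoopContDiff 1 f) :
    IsWeakDeriv (contLoop f hf.continuous)
      (contLoop (loopDeriv f) (hf.continuous_loopDeriv le_rfl)) := by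
  intro φ hφ
  have e1 : ∫ t, loopDeriv φ t • contLoop f hf.continuous t = ∫ t, loopDeriv φ t • f t := by
    apply integral_congr_ae
    filter_upwards [contLoop_ae f hf.continuous] with t ht
    rw [ht]
  have e2 : ∫ t, φ t • contLoop (loopDeriv f) (hf.continuous_loopDeriv le_rfl) t
      = ∫ t, φ t • loopDeriv f t := by
    apply integral_congr_ae
    filter_upwards [contLoop_ae _ (hf.continuous_loopDeriv le_rfl)] with t ht
    rw [ht]
  rw [e1, e2, ← AddCircle.intervalIntegral_preimage T 0, ← AddCircle.intervalIntegral_preimage T 0]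
  simp only [loopDeriv_coe]
  have dφ : Differentiable ℝ (fun t : ℝ => φ (t : AddCircle T)) :=
    ContDiff.differentiable hφ (by simp)
  have df : Differentiable ℝ (fun t : ℝ => f (t : AddCircle T)) :=
    ContDiff.differentiable hf (by simp)
  have cφ : Continuous (deriv fun t : ℝ => φ (t : AddCircle T)) :=
    ContDiff.continuous_deriv hφ (by norm_cast)
  have cf : Continuous (deriv fun t : ℝ => f (t : AddCircle T)) :=
    ContDiff.continuous_deriv hf (by norm_cast)
  have := intervalIntegral.integral_smul_deriv_eq_deriv_smul (a := 0) (b := 0 + T)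
    (u := fun t : ℝ => φ (t : AddCircle T)) (v := fun t : ℝ => f (t : AddCircle T))
    (fun t _ => (dφ t).hasDerivAt) (fun t _ => (df t).hasDerivAt)
    (cφ.intervalIntegrable _ _) (cf.intervalIntegrable _ _)
  rw [this]
  simp [AddCircle.coe_period]

/-- An even `T`-periodic `C²` function as an element of `H2Even T`. -/
def classicalLoop (x : AddCircle T → Cell) (hx : LoopContDiff 2 x) (hev : ∀ t, x (-t) = x t) :
    H2Even T :=
  ⟨WithLp.toLp 2 ![contLoop x hx.continuous,
      contLoop (loopDeriv x) (hx.continuous_loopDeriv (by norm_num)),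
      contLoop (loopDeriv (loopDeriv x)) (hx.loopDeriv_succ.continuous_loopDeriv le_rfl)], by
    refine ⟨isWeakDeriv_contLoop x (ContDiff.of_le hx (by norm_num)),
      isWeakDeriv_contLoop (loopDeriv x) hx.loopDeriv_succ, ?_⟩
    have h0 := contLoop_ae x hx.continuous
    have h1 := (Measure.measurePreserving_neg (volume : Measure (AddCircle T))
      ).quasiMeasurePreserving.ae h0
    filter_upwards [h0, h1] with t a b
    exact b.trans ((hev t).trans a.symm)⟩

/-- The sequence `X_* = {…, 0, 0, x_*, 0, 0, …}` in which only the dimer `n = 0` is excited. -/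
def seed {V : ℝ → ℝ} {γ : ℝ} {x : AddCircle T → Cell} (hx : IsDimerOrbit V γ x) :
    BreatherSpace T :=
  lp.single 2 0 (classicalLoop x hx.contDiff hx.even)

end DimerArray

end

/-!
Let `D = d²/dt²`, acting on even `T`-periodic functions. Since `D - 1` is an isomorphism from even
`H²` to even `L²`, the equation `F(X, s) = 0` is equivalent to `Φ(s, X) = 0`, where
`Φ(s, X) = X + (D - 1)⁻¹ (g(X) + X + s R X)` (`preconditioned`) and `g` is the on-site force
`onsite V γ`, acting componentwise. The breathers come from the implicit function theorem applied
to `Φ` at `(0, X_*)` (`exists_curve_of_contDiff`), and three facts make it applicable.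

* `Φ` is of class `C¹`. By the embedding `contRep` of `H²` into the continuous functions, it
  suffices that `X ↦ (g ∘ Xₙ)ₙ` is `C¹` on square-summable sequences of *continuous* functions
  (`contDiff_superposition`). There it follows from the uniform differentiability of `g` on bounded
  sets: pointwise estimates with constants independent of the site sum up. The coupling is linear
  and bounded (`coupling`).
* The derivative of `Φ` in `X` at `(0, X_*)` is diagonal in the site, with entry
  `1 + (D - 1)⁻¹ (g'(x(t)) + 1)`, where `x = x_*` at the excited site and `x = 0` elsewhere
  (`siteLin`). Each entry is a compact perturbation of the identity, since `contRep` is compact, and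
  hence invertible as soon as it is injective (`exists_equiv_siteLin`). As only two different
  entries occur, the inverses are uniformly bounded, so the whole diagonal operator is invertible.
* The entries are injective: at the excited site by non-degeneracy, elsewhere because the cosine
  coefficients of an element of the kernel are annihilated by the matrices
  `-(nω)² + V''(0) - γ σ`, `σ` the exchange matrix, which are invertible by non-resonance
  (`eq_zero_of_nonresonance`).

The linear theory of `H²` is obtained from completeness of the Fourier modes
(`eq_zero_of_modes`): it yields uniqueness of weak derivatives and injectivity of `D - 1`, and
identifies an even `H²` function with the sum of its cosine series. That series converges in the
operator norm, because the `n`-th coefficient is `O(n⁻²)`; so `contRep` is a norm limit of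
finite-rank operators. Surjectivity of `D - 1` is the Riesz representation theorem in `H¹`, in the
form that the adjoint of the inclusion of `H¹` into `L²` solves `u - u'' = f` weakly
(`isWeakDeriv_weakSolve`).
-/

noncomputable section

namespace DimerArray

/-! ### Superposition operators on `ℓ²` sequences of continuous functions -/

section Superposition

variable {ι K E : Type*} [TopologicalSpace K] [CompactSpace K]
  [NormedAddCommGroup E] [NormedSpace ℝ E]

theorem lp_norm_le_mul_norm {F₁ F₂ : ι → Type*} [∀ i, NormedAddCommGroup (F₁ i)]
    [∀ i, NormedAddCommGroup (F₂ i)] {c : ℝ} (hc : 0 ≤ c) (z : lp F₁ 2) (h : lp F₂ 2)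
    (hzh : ∀ i, ‖z i‖ ≤ c * ‖h i‖) : ‖z‖ ≤ c * ‖h‖ := by
  refine lp.norm_le_of_forall_sum_le (by norm_num) (by positivity) fun s => ?_
  have h1 := lp.sum_rpow_le_norm_rpow (by norm_num) h s
  calc ∑ i ∈ s, ‖z i‖ ^ (2 : ℝ≥0∞).toReal
      ≤ ∑ i ∈ s, c ^ (2 : ℝ≥0∞).toReal * ‖h i‖ ^ (2 : ℝ≥0∞).toReal := by
        refine Finset.sum_le_sum fun i _ => ?_
        rw [← Real.mul_rpow hc (norm_nonneg _)]
        exact Real.rpow_le_rpow (norm_nonneg _) (hzh i) (by norm_num)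
    _ ≤ (c * ‖h‖) ^ (2 : ℝ≥0∞).toReal := by
        rw [← Finset.mul_sum, Real.mul_rpow hc (norm_nonneg _)]
        gcongr

theorem memℓp_of_norm_le_mul {F₁ F₂ : ι → Type*} [∀ i, NormedAddCommGroup (F₁ i)]
    [∀ i, NormedAddCommGroup (F₂ i)] {c : ℝ} {z : ∀ i, F₁ i} (h : lp F₂ 2)
    (hzh : ∀ i, ‖z i‖ ≤ c * ‖h i‖) : Memℓp z 2 :=
  (((lp.memℓp h).norm.const_mul c).mono hzh)

/-- Pointwise application of a continuous family of operators to a continuous function. -/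
def applyFamily (q : C(K, E →L[ℝ] E)) : C(K, E) →L[ℝ] C(K, E) :=
  LinearMap.mkContinuous
    { toFun := fun f => ⟨fun t => q t (f t), q.continuous.clm_apply f.continuous⟩
      map_add' := fun f f' => by ext t; simp
      map_smul' := fun c f => by ext t; simp } ‖q‖
    fun f => by
      refine (ContinuousMap.norm_le _ (by positivity)).2 fun t => ?_
      exact ((q t).le_opNorm _).trans
        (mul_le_mul (q.norm_coe_le_norm t) (f.norm_coe_le_norm t) (norm_nonneg _) (norm_nonneg q))

theorem norm_applyFamily_le (q : C(K, E →L[ℝ] E)) : ‖applyFamily q‖ ≤ ‖q‖ :=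
  LinearMap.mkContinuous_norm_le _ (norm_nonneg q) _

variable {g : E → E}

/-- On bounded sets a `C¹` map on a finite-dimensional space is differentiable uniformly, with
uniformly continuous derivative. -/
theorem exists_uniform_fderiv [ProperSpace E] (hg : ContDiff ℝ 1 g) (M : ℝ) {ε : ℝ} (hε : 0 < ε) :
    ∃ δ > 0, ∀ a b : E, ‖a‖ ≤ M → ‖b - a‖ ≤ δ →
      ‖fderiv ℝ g b - fderiv ℝ g a‖ ≤ ε ∧ ‖g b - g a - fderiv ℝ g a (b - a)‖ ≤ ε * ‖b - a‖ := by
  have hc : Continuous (fderiv ℝ g) := hg.continuous_fderiv (by norm_num)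
  have hu := (isCompact_closedBall (0 : E) (M + 1)).uniformContinuousOn_of_continuous
    hc.continuousOn
  obtain ⟨δ, hδ, H⟩ := Metric.uniformContinuousOn_iff_le.1 hu ε hε
  have key : ∀ a b : E, ‖a‖ ≤ M → ‖b - a‖ ≤ min δ 1 → ‖fderiv ℝ g b - fderiv ℝ g a‖ ≤ ε := by
    intro a b ha hb
    rw [← dist_eq_norm]
    refine H b ?_ a ?_ ?_
    · rw [mem_closedBall_zero_iff]
      have := norm_le_norm_add_norm_sub' b a
      have := hb.trans (min_le_right _ _)
      linarith
    · rw [mem_closedBall_zero_iff]; linarith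
    · rw [dist_eq_norm]; exact hb.trans (min_le_left _ _)
  refine ⟨min δ 1, by positivity, fun a b ha hb => ⟨key a b ha hb, ?_⟩⟩
  refine (convex_closedBall a (min δ 1)).norm_image_sub_le_of_norm_hasFDerivWithin_le'
    (f' := fderiv ℝ g)
    (fun x _ => ((hg.differentiable (by norm_num)) x).hasFDerivAt.hasFDerivWithinAt)
    (fun x hx => ?_) (Metric.mem_closedBall_self (by positivity)) ?_
  · exact key a x ha (by simpa [dist_eq_norm] using hx)
  · simpa [dist_eq_norm] using hb

theorem exists_norm_fderiv_le [ProperSpace E] (hg : ContDiff ℝ 1 g) (M : ℝ) :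
    ∃ C, 0 ≤ C ∧ ∀ a : E, ‖a‖ ≤ M → ‖fderiv ℝ g a‖ ≤ C := by
  have hc : Continuous (fderiv ℝ g) := hg.continuous_fderiv (by norm_num)
  obtain ⟨C, hC⟩ := (isCompact_closedBall (0 : E) M).exists_bound_of_continuousOn hc.continuousOn
  exact ⟨max C 0, le_max_right _ _, fun a ha =>
    (hC a (by simpa using ha)).trans (le_max_left _ _)⟩

theorem norm_lp_apply_apply_le {F : Type*} [NormedAddCommGroup F]
    (X : lp (fun _ : ι => C(K, F)) 2) (n : ι) (t : K) :
    ‖X n t‖ ≤ ‖X‖ :=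
  ((X n).norm_coe_le_norm t).trans (lp.norm_apply_le_norm (by norm_num) X n)

theorem memℓp_superposition [ProperSpace E] (hg : ContDiff ℝ 1 g) (h0 : g 0 = 0)
    (X : lp (fun _ : ι => C(K, E)) 2) :
    Memℓp (fun n => (⟨fun t => g (X n t), hg.continuous.comp (X n).continuous⟩ : C(K, E))) 2 := by
  obtain ⟨C, hC0, hC⟩ := exists_norm_fderiv_le hg ‖X‖
  refine memℓp_of_norm_le_mul (c := C) X fun n => ?_
  refine (ContinuousMap.norm_le _ (by positivity)).2 fun t => ?_
  have h1 := (convex_closedBall (0 : E) ‖X‖).norm_image_sub_le_of_norm_hasFDerivWithin_le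
    (f' := fderiv ℝ g) (f := g) (x := 0) (y := X n t) (C := C)
    (fun x _ => ((hg.differentiable (by norm_num)) x).hasFDerivAt.hasFDerivWithinAt)
    (fun x hx => hC x (by simpa using hx)) (by simp)
    (by simpa using norm_lp_apply_apply_le X n t)
  rw [h0, sub_zero, sub_zero] at h1
  exact h1.trans (by gcongr; exact (X n).norm_coe_le_norm t)

/-- The superposition operator `X ↦ (g ∘ Xₙ)ₙ` on square-summable sequences of continuous
functions. -/
def superposition [ProperSpace E] (hg : ContDiff ℝ 1 g) (h0 : g 0 = 0)
    (X : lp (fun _ : ι => C(K, E)) 2) : lp (fun _ : ι => C(K, E)) 2 :=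
  ⟨fun n => ⟨fun t => g (X n t), hg.continuous.comp (X n).continuous⟩,
    memℓp_superposition hg h0 X⟩

/-- The derivative of `g` along a continuous function. -/
def fderivAlong (hg : ContDiff ℝ 1 g) (f : C(K, E)) : C(K, E →L[ℝ] E) :=
  ⟨fun t => fderiv ℝ g (f t), (hg.continuous_fderiv (by norm_num)).comp f.continuous⟩

theorem exists_norm_applyFamily_fderivAlong_le [ProperSpace E] (hg : ContDiff ℝ 1 g)
    (X : lp (fun _ : ι => C(K, E)) 2) :
    ∃ C, 0 ≤ C ∧ ∀ n, ‖applyFamily (fderivAlong hg (X n))‖ ≤ C := by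
  obtain ⟨C, hC0, hC⟩ := exists_norm_fderiv_le hg ‖X‖
  exact ⟨C, hC0, fun n => (norm_applyFamily_le _).trans
    ((ContinuousMap.norm_le _ hC0).2 fun t => hC _ (norm_lp_apply_apply_le X n t))⟩

/-- The derivative of the superposition operator: multiplication by `g' ∘ Xₙ` in the `n`-th
component. -/
def superpositionDeriv [ProperSpace E] (hg : ContDiff ℝ 1 g) (X : lp (fun _ : ι => C(K, E)) 2) :
    lp (fun _ : ι => C(K, E)) 2 →L[ℝ] lp (fun _ : ι => C(K, E)) 2 :=
  lp.mapCLM 2 (fun n => applyFamily (fderivAlong hg (X n)))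
    (exists_norm_applyFamily_fderivAlong_le hg X).choose_spec.1
    (exists_norm_applyFamily_fderivAlong_le hg X).choose_spec.2

theorem hasFDerivAt_superposition [ProperSpace E] (hg : ContDiff ℝ 1 g) (h0 : g 0 = 0)
    (X : lp (fun _ : ι => C(K, E)) 2) :
    HasFDerivAt (superposition hg h0) (superpositionDeriv hg X) X := by
  refine HasFDerivAt.of_isLittleO (Asymptotics.isLittleO_iff.2 fun c hc => ?_)
  obtain ⟨δ, hδ, H⟩ := exists_uniform_fderiv hg ‖X‖ hc
  filter_upwards [Metric.closedBall_mem_nhds X hδ] with Y hY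
  refine lp_norm_le_mul_norm hc.le _ _ fun n => ?_
  refine (ContinuousMap.norm_le _ (by positivity)).2 fun t => ?_
  have h1 : ‖Y n t - X n t‖ ≤ ‖(Y - X) n‖ := ((Y - X) n).norm_coe_le_norm t
  have h2 : ‖(Y - X) n‖ ≤ ‖Y - X‖ := lp.norm_apply_le_norm (by norm_num) _ n
  rw [Metric.mem_closedBall, dist_eq_norm] at hY
  have h3 := (H (X n t) (Y n t) (norm_lp_apply_apply_le X n t) (by linarith)).2
  exact h3.trans (by gcongr)

theorem continuous_superpositionDeriv [ProperSpace E] (hg : ContDiff ℝ 1 g) :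
    Continuous (superpositionDeriv (ι := ι) (K := K) hg) := by
  refine Metric.continuous_iff.2 fun X ε hε => ?_
  obtain ⟨δ, hδ, H⟩ := exists_uniform_fderiv hg ‖X‖ (half_pos hε)
  refine ⟨δ, hδ, fun Y hY => ?_⟩
  rw [dist_eq_norm] at hY ⊢
  refine lt_of_le_of_lt ?_ (half_lt_self hε)
  refine ContinuousLinearMap.opNorm_le_bound _ (by positivity) fun Z => ?_
  refine lp_norm_le_mul_norm (by positivity) _ _ fun n => ?_
  refine (ContinuousMap.norm_le _ (by positivity)).2 fun t => ?_
  have h1 : ‖Y n t - X n t‖ ≤ ‖(Y - X) n‖ := ((Y - X) n).norm_coe_le_norm t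
  have h2 : ‖(Y - X) n‖ ≤ ‖Y - X‖ := lp.norm_apply_le_norm (by norm_num) _ n
  have h3 := (H (X n t) (Y n t) (norm_lp_apply_apply_le X n t) (by linarith)).1
  exact ((fderiv ℝ g (Y n t) - fderiv ℝ g (X n t)).le_opNorm (Z n t)).trans
    (mul_le_mul h3 ((Z n).norm_coe_le_norm t) (norm_nonneg _) (by positivity))

/-- The superposition operator of a `C¹` map fixing the origin is of class `C¹` on
square-summable sequences of continuous functions. -/
theorem contDiff_superposition [ProperSpace E] (hg : ContDiff ℝ 1 g) (h0 : g 0 = 0) :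
    ContDiff ℝ 1 (superposition (ι := ι) (K := K) hg h0) :=
  contDiff_one_iff_hasFDerivAt.2 ⟨superpositionDeriv hg, continuous_superpositionDeriv hg,
    hasFDerivAt_superposition hg h0⟩

end Superposition

/-! ### Invertibility and the implicit function theorem -/

section Abstract

/-- Isomorphisms with uniformly bounded norms and uniformly bounded inverses act invertibly on
`ℓ²` sequences. -/
theorem isInvertible_mapCLM {ι : Type*} {E : Type*} [NormedAddCommGroup E] [NormedSpace ℝ E]
    (e : ι → E ≃L[ℝ] E) (A : ι → E →L[ℝ] E)
    (hA : ∀ i, A i = e i) {C : ℝ} (hC : 0 ≤ C) (hAC : ∀ i, ‖A i‖ ≤ C) {C' : ℝ} (hC' : 0 ≤ C')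
    (hC'e : ∀ i, ‖((e i).symm : E →L[ℝ] E)‖ ≤ C') :
    (lp.mapCLM 2 A hC hAC).IsInvertible := by
  refine ContinuousLinearMap.IsInvertible.of_inverse
    (g := lp.mapCLM 2 (fun i => ((e i).symm : E →L[ℝ] E)) hC' hC'e) ?_ ?_
  · ext X i
    simp [hA]
  · ext X i
    simp [hA]

variable {E : Type*} [NormedAddCommGroup E] [NormedSpace ℝ E] [CompleteSpace E]

/-- The Fredholm alternative: a compact perturbation of the identity is invertible if it is
injective. -/
theorem exists_equiv_of_isCompactOperator {K : E →L[ℝ] E} (hK : IsCompactOperator K)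
    (hinj : ∀ y, y + K y = 0 → y = 0) : ∃ e : E ≃L[ℝ] E, ∀ y, e y = y + K y := by
  rcases hK.hasEigenvalue_or_mem_resolventSet (μ := -1) (by norm_num) with h | h
  -- An eigenvector of `K` for the eigenvalue `-1` lies in the kernel of `1 + K`.
  · obtain ⟨y, hy⟩ := h.exists_hasEigenvector
    refine absurd (hinj y ?_) hy.2
    have := hy.apply_eq_smul
    simp only [ContinuousLinearMap.coe_coe] at this
    rw [this]; simp
  · rw [spectrum.mem_resolventSet_iff, ← IsUnit.neg_iff] at h
    obtain ⟨u, hu⟩ := h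
    refine ⟨ContinuousLinearEquiv.ofUnit u, fun y => ?_⟩
    change (u : E →L[ℝ] E) y = _
    rw [hu]
    simp [add_comm]

open Topology in
/-- The implicit function theorem with one real parameter, near the parameter value `0`. -/
theorem exists_curve_of_contDiff {f : ℝ × E → E} (hf : ContDiff ℝ 1 f) {a : E} (ha : f (0, a) = 0)
    {f' : ℝ × E →L[ℝ] E} (hf' : HasFDerivAt f f' (0, a))
    (hinv : (f' ∘L .inr ℝ ℝ E).IsInvertible) :
    ∃ r > 0, ∃ X : ℝ → E, ContDiffOn ℝ 1 X (Set.Ico 0 r) ∧ X 0 = a ∧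
      ∀ s ∈ Set.Ico 0 r, f (s, X s) = 0 := by
  have cdf : ContDiffAt ℝ 1 f (0, a) := hf.contDiffAt
  rw [← hf'.fderiv] at hinv
  have h1 := (cdf.contDiffAt_implicitFunction one_ne_zero hinv).eventually (by simp)
  have h2 := cdf.eventually_apply_implicitFunction one_ne_zero hinv
  obtain ⟨r, hr, H⟩ := Metric.eventually_nhds_iff.1 (h1.and h2)
  have hd : ∀ s ∈ Set.Ico 0 r, dist s ((0 : ℝ), a).1 < r := fun s hs => by
    simpa [abs_of_nonneg hs.1] using hs.2
  refine ⟨r, hr, cdf.implicitFunction one_ne_zero hinv,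
    fun s hs => (H (hd s hs)).1.contDiffWithinAt,
    cdf.implicitFunction_apply_self one_ne_zero hinv, fun s hs => ?_⟩
  rw [(H (hd s hs)).2, ha]

end Abstract

/-! ### Pairings with test functions and weak derivatives -/

section Pairing

variable {T : ℝ}

theorem LoopContDiff.loopDeriv_top {φ : AddCircle T → ℝ} (hφ : LoopContDiff (⊤ : ℕ∞) φ) :
    LoopContDiff (⊤ : ℕ∞) (loopDeriv φ) := by
  unfold LoopContDiff at *
  simp only [loopDeriv_coe]
  exact (contDiff_infty_iff_deriv.1 hφ).2

theorem LoopContDiff.comp_neg {φ : AddCircle T → ℝ} {k : ℕ∞} (hφ : LoopContDiff k φ) :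
    LoopContDiff k (fun t => φ (-t)) := by
  have : ContDiff ℝ k (fun t : ℝ => φ ((-t : ℝ) : AddCircle T)) :=
    ContDiff.comp (g := fun t : ℝ => φ (t : AddCircle T)) hφ contDiff_neg
  simpa [LoopContDiff] using this

theorem loopDeriv_comp_neg (φ : AddCircle T → ℝ) (t : AddCircle T) :
    loopDeriv (fun t => φ (-t)) t = -loopDeriv φ (-t) := by
  induction t using QuotientAddGroup.induction_on with
  | H t =>
    have h := deriv_comp_neg (fun s : ℝ => φ (s : AddCircle T)) t
    have h1 := loopDeriv_coe (fun t => φ (-t)) t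
    have h2 := loopDeriv_coe φ (-t)
    rw [← h2] at h
    simpa using h1.trans h

/-- `t ↦ φ t • e` as a continuous loop, depending linearly on the vector `e`. -/
def smulLoop [Fact (0 < T)] (φ : C(AddCircle T, ℝ)) : Cell →L[ℝ] C(AddCircle T, Cell) :=
  LinearMap.mkContinuous
    { toFun := fun e => ⟨fun t => φ t • e, φ.continuous.smul continuous_const⟩
      map_add' := fun e e' => by ext t; simp
      map_smul' := fun c e => by ext t; simp [mul_left_comm] } ‖φ‖
    fun e => by
      refine (ContinuousMap.norm_le _ (by positivity)).2 fun t => ?_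
      change ‖φ t • e‖ ≤ _
      rw [norm_smul]
      gcongr
      exact φ.norm_coe_le_norm t

variable [Fact (0 < T)]

@[simp]
theorem smulLoop_apply (φ : C(AddCircle T, ℝ)) (e : Cell) (t : AddCircle T) :
    smulLoop φ e t = φ t • e := rfl

theorem norm_smulLoop_le (φ : C(AddCircle T, ℝ)) : ‖smulLoop φ‖ ≤ ‖φ‖ :=
  LinearMap.mkContinuous_norm_le _ (norm_nonneg φ) _

variable (T) in
/-- The inclusion of the continuous loops into `L²`. -/
def toL2 : C(AddCircle T, Cell) →L[ℝ] L2Loop T := ContinuousMap.toLp 2 volume ℝ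

theorem toL2_ae (f : C(AddCircle T, Cell)) : ∀ᵐ t : AddCircle T, toL2 T f t = f t :=
  ContinuousMap.coeFn_toLp (𝕜 := ℝ) (p := 2) volume f

theorem inner_toL2_smulLoop (φ : C(AddCircle T, ℝ)) (e : Cell) (u : L2Loop T) :
    inner ℝ (toL2 T (smulLoop φ e)) u = inner ℝ e (∫ t, φ t • u t) := by
  rw [L2.inner_def, ← integral_inner (integrable_smul_L2Loop φ.continuous u)]
  refine integral_congr_ae ?_
  filter_upwards [toL2_ae (smulLoop φ e)] with t ht
  rw [ht, smulLoop_apply, real_inner_smul_left, real_inner_smul_right]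

/-- The pairing `u ↦ ∫ φ u` with a continuous scalar function. -/
def pairing (φ : C(AddCircle T, ℝ)) : L2Loop T →L[ℝ] Cell :=
  LinearMap.mkContinuous
    { toFun := fun u => ∫ t, φ t • u t
      map_add' := fun u v => by
        refine ext_inner_left ℝ fun e => ?_
        rw [inner_add_right, ← inner_toL2_smulLoop, ← inner_toL2_smulLoop, ← inner_toL2_smulLoop,
          inner_add_right]
      map_smul' := fun c u => by
        refine ext_inner_left ℝ fun e => ?_
        rw [RingHom.id_apply, inner_smul_right, ← inner_toL2_smulLoop, ← inner_toL2_smulLoop,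
          inner_smul_right] } (‖toL2 T‖ * ‖φ‖)
    fun u => by
      change ‖∫ t, φ t • u t‖ ≤ _
      -- The norm of `w = ∫ φ u` is found by pairing `u` with the loop `φ • w`.
      set w := ∫ t, φ t • u t with hw
      rcases (norm_nonneg w).eq_or_lt with h | h
      · rw [← h]; positivity
      · refine le_of_mul_le_mul_left ?_ h
        calc ‖w‖ * ‖w‖ = inner ℝ (toL2 T (smulLoop φ w)) u := by
              rw [inner_toL2_smulLoop, ← hw, real_inner_self_eq_norm_mul_norm]
          _ ≤ ‖toL2 T (smulLoop φ w)‖ * ‖u‖ := real_inner_le_norm _ _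
          _ ≤ ‖toL2 T‖ * (‖φ‖ * ‖w‖) * ‖u‖ := by
              gcongr
              refine ((toL2 T).le_opNorm _).trans ?_
              gcongr
              refine ((smulLoop φ).le_opNorm _).trans ?_
              gcongr
              exact norm_smulLoop_le φ
          _ = ‖w‖ * (‖toL2 T‖ * ‖φ‖ * ‖u‖) := by ring

theorem pairing_apply (φ : C(AddCircle T, ℝ)) (u : L2Loop T) :
    pairing φ u = ∫ t, φ t • u t := rfl

theorem norm_pairing_le (φ : C(AddCircle T, ℝ)) : ‖pairing φ‖ ≤ ‖toL2 T‖ * ‖φ‖ :=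
  LinearMap.mkContinuous_norm_le _ (by positivity) _

theorem isWeakDeriv_iff (u v : L2Loop T) :
    IsWeakDeriv u v ↔ ∀ (φ : AddCircle T → ℝ) (hφ : LoopContDiff (⊤ : ℕ∞) φ),
      pairing ⟨loopDeriv φ, hφ.continuous_loopDeriv (by norm_num)⟩ u
        = -pairing ⟨φ, hφ.continuous⟩ v := Iff.rfl

theorem isClosed_isWeakDeriv {X : Type*} [TopologicalSpace X] {f g : X → L2Loop T}
    (hf : Continuous f) (hg : Continuous g) : IsClosed {x | IsWeakDeriv (f x) (g x)} := by
  simp only [isWeakDeriv_iff, Set.ofPred_forall]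
  exact isClosed_iInter fun φ => isClosed_iInter fun hφ => isClosed_eq (by fun_prop) (by fun_prop)

/-- Moving two derivatives onto the test function. -/
theorem IsWeakDeriv.integral_second {u v w : L2Loop T} (h1 : IsWeakDeriv u v)
    (h2 : IsWeakDeriv v w) {φ : AddCircle T → ℝ} (hφ : LoopContDiff (⊤ : ℕ∞) φ) :
    ∫ t, loopDeriv (loopDeriv φ) t • u t = ∫ t, φ t • w t := by
  rw [h1 _ hφ.loopDeriv_top, h2 _ hφ, neg_neg]

theorem IsWeakDeriv.neg {u v : L2Loop T} (h : IsWeakDeriv u v) : IsWeakDeriv (-u) (-v) := by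
  simpa using h.smul (-1)

theorem IsWeakDeriv.sub {u v u' v' : L2Loop T} (h : IsWeakDeriv u v) (h' : IsWeakDeriv u' v') :
    IsWeakDeriv (u - u') (v - v') := by
  simpa [sub_eq_add_neg] using h.add h'.neg

end Pairing

section Reflection

variable {T : ℝ} [Fact (0 < T)]

variable (T) in
/-- Time reversal `u ↦ u(-·)` on `L²`. -/
def reflect : L2Loop T →L[ℝ] L2Loop T :=
  (Lp.compMeasurePreservingₗᵢ ℝ (fun t : AddCircle T => -t)
    (Measure.measurePreserving_neg (volume : Measure (AddCircle T)))).toContinuousLinearMap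

theorem reflect_ae (u : L2Loop T) : ∀ᵐ t : AddCircle T, reflect T u t = u (-t) :=
  Lp.coeFn_compMeasurePreserving u (Measure.measurePreserving_neg volume)

theorem ae_neg {p : AddCircle T → Prop} (h : ∀ᵐ t, p t) : ∀ᵐ t, p (-t) :=
  (Measure.measurePreserving_neg (volume : Measure (AddCircle T))).quasiMeasurePreserving.ae h

theorem reflect_eq_self_iff (u : L2Loop T) :
    reflect T u = u ↔ ∀ᵐ t : AddCircle T, u (-t) = u t := by
  constructor
  · intro h
    filter_upwards [reflect_ae u] with t ht
    rw [← ht, h]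
  · intro h
    refine Lp.ext ?_
    filter_upwards [h, reflect_ae u] with t h1 h2
    rw [h2, h1]

theorem reflect_reflect (u : L2Loop T) : reflect T (reflect T u) = u := by
  refine Lp.ext ?_
  filter_upwards [reflect_ae (reflect T u), ae_neg (reflect_ae u)] with t h1 h2
  rw [h1, h2, neg_neg]

theorem integral_smul_reflect (φ : AddCircle T → ℝ) (u : L2Loop T) :
    ∫ t, φ t • reflect T u t = ∫ t, φ (-t) • u t := by
  rw [← integral_neg_eq_self (fun t => φ (-t) • u t)]
  refine integral_congr_ae ?_
  filter_upwards [reflect_ae u] with t ht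
  rw [ht, neg_neg]

/-- The weak derivative of a reflected function. -/
theorem IsWeakDeriv.reflect {u v : L2Loop T} (h : IsWeakDeriv u v) :
    IsWeakDeriv (reflect T u) (-reflect T v) := by
  intro φ hφ
  have h1 := h _ hφ.comp_neg
  simp only [loopDeriv_comp_neg, neg_smul, integral_neg] at h1
  rw [integral_smul_reflect, neg_inj.1 h1, ← integral_smul_reflect, ← integral_neg]
  refine integral_congr_ae ?_
  filter_upwards [Lp.coeFn_neg (DimerArray.reflect T v)] with t ht
  rw [ht]; simp

end Reflection

/-! ### Fourier modes -/

section Modes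

variable {T : ℝ}

variable (T) in
/-- The function `t ↦ cos (2 π n t / T)`. -/
def cosMode (n : ℤ) : C(AddCircle T, ℝ) :=
  ⟨fun t => (fourier n t).re, Complex.continuous_re.comp (fourier n).continuous⟩

variable (T) in
/-- The function `t ↦ sin (2 π n t / T)`. -/
def sinMode (n : ℤ) : C(AddCircle T, ℝ) :=
  ⟨fun t => (fourier n t).im, Complex.continuous_im.comp (fourier n).continuous⟩

theorem fourier_coe_eq (n : ℤ) (t : ℝ) : fourier n (t : AddCircle T) =
    Complex.exp ((n * (2 * Real.pi / T) * t : ℝ) * Complex.I) := by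
  rw [fourier_coe_apply]
  congr 1
  push_cast
  ring

theorem cosMode_coe (n : ℤ) (t : ℝ) :
    cosMode T n (t : AddCircle T) = Real.cos (n * (2 * Real.pi / T) * t) := by
  change (fourier n (t : AddCircle T)).re = _
  rw [fourier_coe_eq, Complex.exp_ofReal_mul_I_re]

theorem sinMode_coe (n : ℤ) (t : ℝ) :
    sinMode T n (t : AddCircle T) = Real.sin (n * (2 * Real.pi / T) * t) := by
  change (fourier n (t : AddCircle T)).im = _
  rw [fourier_coe_eq, Complex.exp_ofReal_mul_I_im]

theorem cosMode_neg (n : ℤ) (t : AddCircle T) : cosMode T n (-t) = cosMode T n t := by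
  induction t using QuotientAddGroup.induction_on with
  | H t =>
    have h1 := cosMode_coe (T := T) n (-t)
    rw [mul_neg, Real.cos_neg, ← cosMode_coe] at h1
    simpa using h1

theorem sinMode_neg (n : ℤ) (t : AddCircle T) : sinMode T n (-t) = -sinMode T n t := by
  induction t using QuotientAddGroup.induction_on with
  | H t =>
    have h1 := sinMode_coe (T := T) n (-t)
    rw [mul_neg, Real.sin_neg, ← sinMode_coe] at h1
    simpa using h1

theorem cosMode_neg_index (n : ℤ) : cosMode T (-n) = cosMode T n := by
  ext t
  induction t using QuotientAddGroup.induction_on with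
  | H t =>
    refine (cosMode_coe (T := T) (-n) t).trans ?_
    rw [Int.cast_neg, neg_mul, neg_mul, Real.cos_neg]
    exact (cosMode_coe n t).symm

theorem norm_cosMode_le [Fact (0 < T)] (n : ℤ) : ‖cosMode T n‖ ≤ 1 := by
  refine (ContinuousMap.norm_le _ zero_le_one).2 fun t => ?_
  induction t using QuotientAddGroup.induction_on with
  | H t =>
    change ‖cosMode T n (t : AddCircle T)‖ ≤ 1
    rw [cosMode_coe]
    exact Real.abs_cos_le_one _

theorem loopContDiff_cosMode (n : ℤ) : LoopContDiff (⊤ : ℕ∞) (cosMode T n) := by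
  unfold LoopContDiff
  simp only [cosMode_coe]
  exact Real.contDiff_cos.comp (by fun_prop)

theorem loopContDiff_sinMode (n : ℤ) : LoopContDiff (⊤ : ℕ∞) (sinMode T n) := by
  unfold LoopContDiff
  simp only [sinMode_coe]
  exact Real.contDiff_sin.comp (by fun_prop)

theorem hasDerivAt_cos_mul (a t : ℝ) :
    HasDerivAt (fun t : ℝ => Real.cos (a * t)) (-a * Real.sin (a * t)) t := by
  convert! (Real.hasDerivAt_cos (a * t)).comp t ((hasDerivAt_id t).const_mul a) using 1
  simp; ring

theorem hasDerivAt_sin_mul (a t : ℝ) :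
    HasDerivAt (fun t : ℝ => Real.sin (a * t)) (a * Real.cos (a * t)) t := by
  convert! (Real.hasDerivAt_sin (a * t)).comp t ((hasDerivAt_id t).const_mul a) using 1
  simp; ring

theorem loopDeriv_loopDeriv_cosMode (n : ℤ) (t : AddCircle T) :
    loopDeriv (loopDeriv (cosMode T n)) t = -(n * (2 * Real.pi / T)) ^ 2 * cosMode T n t := by
  induction t using QuotientAddGroup.induction_on with
  | H t =>
    refine (loopDeriv_coe _ t).trans ?_
    refine Eq.trans ?_ (congrArg _ (cosMode_coe n t).symm)
    simp only [loopDeriv_coe, cosMode_coe, (hasDerivAt_cos_mul _ _).deriv]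
    rw [((hasDerivAt_sin_mul _ t).const_mul _).deriv]
    ring

theorem loopDeriv_loopDeriv_sinMode (n : ℤ) (t : AddCircle T) :
    loopDeriv (loopDeriv (sinMode T n)) t = -(n * (2 * Real.pi / T)) ^ 2 * sinMode T n t := by
  induction t using QuotientAddGroup.induction_on with
  | H t =>
    refine (loopDeriv_coe _ t).trans ?_
    refine Eq.trans ?_ (congrArg _ (sinMode_coe n t).symm)
    simp only [loopDeriv_coe, sinMode_coe, (hasDerivAt_sin_mul _ _).deriv]
    rw [((hasDerivAt_cos_mul _ t).const_mul _).deriv]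
    ring

variable [Fact (0 < T)]

/-- The Fourier coefficients of the second weak derivative: `φ` is an eigenfunction of `d²/dt²`
with eigenvalue `-κ`. -/
theorem integral_mode_second {u v w : L2Loop T} (h1 : IsWeakDeriv u v) (h2 : IsWeakDeriv v w)
    {φ : AddCircle T → ℝ} (hφ : LoopContDiff (⊤ : ℕ∞) φ) {κ : ℝ}
    (hκ : ∀ t, loopDeriv (loopDeriv φ) t = -κ * φ t) :
    ∫ t, φ t • w t = -κ • ∫ t, φ t • u t := by
  rw [← h1.integral_second h2 hφ, ← integral_smul]
  simp only [hκ, mul_smul]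

/-- A function in `L²` is determined by its Fourier coefficients. -/
theorem eq_zero_of_modes (u : L2Loop T) (hc : ∀ n : ℤ, ∫ t, cosMode T n t • u t = 0)
    (hs : ∀ n : ℤ, ∫ t, sinMode T n t • u t = 0) : u = 0 := by
  -- The complex Fourier coefficients of each real component vanish.
  have comp : ∀ j : Fin 2, ∀ᵐ t : AddCircle T, u t j = 0 := by
    intro j
    have hj : ∀ φ : C(AddCircle T, ℝ), ∫ t, φ t • u t = 0 → ∫ t, φ t * u t j = 0 := by
      intro φ h
      have := (EuclideanSpace.proj j : Cell →L[ℝ] ℝ).integral_comp_comm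
        (integrable_smul_L2Loop φ.continuous u)
      rw [h, map_zero] at this
      simpa using this
    have hi : ∀ φ : C(AddCircle T, ℝ), Integrable (fun t => φ t * u t j) volume := by
      intro φ
      simpa using (EuclideanSpace.proj j : Cell →L[ℝ] ℝ).integrable_comp
        (integrable_smul_L2Loop φ.continuous u)
    set f : AddCircle T → ℂ := fun t => ((u t j : ℝ) : ℂ) with hf
    have hfm : MemLp f 2 volume :=
      (Complex.ofRealCLM.comp (EuclideanSpace.proj j : Cell →L[ℝ] ℝ)).comp_memLp' (Lp.memLp u)
    have hfm' := hfm.haarAddCircle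
    have hcoeff : ∀ n : ℤ, fourierCoeff (hfm'.toLp f) n = 0 := by
      intro n
      rw [fourierCoeff_congr_ae hfm'.coeFn_toLp, fourierCoeff, AddCircle.integral_haarAddCircle]
      have e : ∀ t, fourier (-n) t • f t
          = ((cosMode T n t * u t j : ℝ) : ℂ) - Complex.I * ((sinMode T n t * u t j : ℝ) : ℂ) := by
        intro t
        rw [fourier_neg]
        apply Complex.ext <;> simp [hf, cosMode, sinMode]
      simp only [e]
      rw [integral_sub (hi _).ofReal ((hi _).ofReal.const_mul _), integral_const_mul,
        integral_complex_ofReal, integral_complex_ofReal, hj _ (hc n), hj _ (hs n)]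
      simp
    have hsum := hasSum_fourier_series_L2 (hfm'.toLp f)
    simp only [hcoeff, zero_smul] at hsum
    have hz : hfm'.toLp f = 0 := hsum.unique hasSum_zero
    have hae : f =ᵐ[AddCircle.haarAddCircle] 0 :=
      hfm'.coeFn_toLp.symm.trans (hz ▸ Lp.coeFn_zero _ _ _)
    have hae' : f =ᵐ[volume] 0 := by
      rw [AddCircle.volume_eq_smul_haarAddCircle]
      exact Measure.ae_smul_measure hae _
    filter_upwards [hae'] with t ht
    simpa [hf] using ht
  refine Lp.ext ?_
  filter_upwards [comp 0, comp 1, Lp.coeFn_zero Cell 2 (volume : Measure (AddCircle T))]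
    with t h0 h1 h
  rw [h]
  ext j
  fin_cases j
  · exact h0
  · exact h1

theorem integral_sinMode_eq_zero {u : L2Loop T} (hu : reflect T u = u) (n : ℤ) :
    ∫ t, sinMode T n t • u t = 0 := by
  have h := integral_smul_reflect (sinMode T n) u
  rw [hu] at h
  simp only [sinMode_neg, neg_smul, integral_neg] at h
  rw [eq_neg_iff_add_eq_zero, ← two_smul ℝ] at h
  exact (smul_eq_zero.1 h).resolve_left two_ne_zero

/-- An even function in `L²` is determined by its cosine coefficients. -/
theorem eq_zero_of_cosModes {u : L2Loop T} (hu : reflect T u = u)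
    (hc : ∀ n : ℤ, ∫ t, cosMode T n t • u t = 0) : u = 0 :=
  eq_zero_of_modes u hc (integral_sinMode_eq_zero hu)

/-- The operator `d²/dt² - 1` is injective on periodic functions. -/
theorem eq_zero_of_second_eq_self {u v : L2Loop T} (h1 : IsWeakDeriv u v) (h2 : IsWeakDeriv v u) :
    u = 0 := by
  have key : ∀ {φ : AddCircle T → ℝ} {κ : ℝ}, LoopContDiff (⊤ : ℕ∞) φ → 0 ≤ κ →
      (∀ t, loopDeriv (loopDeriv φ) t = -κ * φ t) → ∫ t, φ t • u t = 0 := by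
    intro φ κ hφ hκ h
    have h3 := integral_mode_second h1 h2 hφ h
    have h4 : (1 + κ) • ∫ t, φ t • u t = 0 := by
      rw [add_smul, one_smul]
      nth_rewrite 1 [h3]
      simp
    exact (smul_eq_zero.1 h4).resolve_left (by positivity)
  exact eq_zero_of_modes u
    (fun n => key (loopContDiff_cosMode n) (sq_nonneg _) (loopDeriv_loopDeriv_cosMode n))
    (fun n => key (loopContDiff_sinMode n) (sq_nonneg _) (loopDeriv_loopDeriv_sinMode n))

/-- The zero function has no weak derivative other than zero; by linearity, weak derivatives are
unique. -/
theorem IsWeakDeriv.eq_zero {v : L2Loop T} (h : IsWeakDeriv 0 v) : v = 0 := by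
  have key : ∀ {φ : AddCircle T → ℝ}, LoopContDiff (⊤ : ℕ∞) φ → ∫ t, φ t • v t = 0 := by
    intro φ hφ
    have h1 := (isWeakDeriv_iff _ _).1 h φ hφ
    rw [map_zero] at h1
    exact neg_eq_zero.1 h1.symm
  exact eq_zero_of_modes v (fun n => key (loopContDiff_cosMode n))
    (fun n => key (loopContDiff_sinMode n))

end Modes

variable {T : ℝ} [Fact (0 < T)]

/-! ### The space of even `H²` functions -/

section Even

variable (T) in
/-- The inclusion of `H2Even T` into `L²`. -/
def fnL : H2Even T →L[ℝ] L2Loop T :=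
  (PiLp.proj 2 (fun _ : Fin 3 => L2Loop T) (0 : Fin 3)).comp (H2Even T).subtypeL

variable (T) in
/-- The second weak derivative as a bounded operator. -/
def secondL : H2Even T →L[ℝ] L2Loop T :=
  (PiLp.proj 2 (fun _ : Fin 3 => L2Loop T) (2 : Fin 3)).comp (H2Even T).subtypeL

@[simp] theorem fnL_apply (y : H2Even T) : fnL T y = fn y := rfl

@[simp] theorem secondL_apply (y : H2Even T) : secondL T y = secondDeriv y := rfl

theorem norm_secondDeriv_le (y : H2Even T) : ‖secondDeriv y‖ ≤ ‖y‖ := PiLp.norm_apply_le y.1 2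

instance completeSpace_h2Even : CompleteSpace (H2Even T) := by
  have h0 : ∀ i : Fin 3, Continuous fun z : PiLp 2 (fun _ : Fin 3 => L2Loop T) => z i :=
    fun i => (PiLp.proj (𝕜 := ℝ) 2 (fun _ : Fin 3 => L2Loop T) i).continuous
  refine IsClosed.completeSpace_coe (hs := ?_)
  have h1 := isClosed_isWeakDeriv (h0 0) (h0 1)
  have h2 := isClosed_isWeakDeriv (h0 1) (h0 2)
  have h3 : IsClosed {z : PiLp 2 (fun _ : Fin 3 => L2Loop T) | reflect T (z 0) = z 0} :=
    isClosed_eq ((reflect T).continuous.comp (h0 0)) (h0 0)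
  convert! h1.inter (h2.inter h3) using 1
  ext z
  simp only [Set.mem_inter_iff, Set.mem_ofPred_eq, reflect_eq_self_iff]
  rfl

theorem fn_even (y : H2Even T) : reflect T (fn y) = fn y :=
  (reflect_eq_self_iff _).2 y.2.2.2

theorem IsWeakDeriv.reflect_of_even {u v : L2Loop T} (h : IsWeakDeriv u v)
    (hu : DimerArray.reflect T u = u) : DimerArray.reflect T v = -v := by
  have h1 := h.sub h.reflect
  rw [hu, sub_self, sub_neg_eq_add] at h1
  exact eq_neg_of_add_eq_zero_right h1.eq_zero

theorem IsWeakDeriv.reflect_of_odd {u v : L2Loop T} (h : IsWeakDeriv u v)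
    (hu : DimerArray.reflect T u = -u) : DimerArray.reflect T v = v := by
  have h1 := h.add h.reflect
  rw [hu, add_neg_cancel, ← sub_eq_add_neg] at h1
  exact (sub_eq_zero.1 h1.eq_zero).symm

theorem secondDeriv_even (y : H2Even T) : reflect T (secondDeriv y) = secondDeriv y :=
  y.2.2.1.reflect_of_odd (y.2.1.reflect_of_even (fn_even y))

theorem eq_zero_of_fn_eq_zero {y : H2Even T} (h : fn y = 0) : y = 0 := by
  have h1 : IsWeakDeriv (y.1 0) (y.1 1) := y.2.1
  have h2 : IsWeakDeriv (y.1 1) (y.1 2) := y.2.2.1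
  have h0 : y.1 0 = 0 := h
  rw [h0] at h1
  have h1' := h1.eq_zero
  rw [h1'] at h2
  have h2' := h2.eq_zero
  ext i : 2
  fin_cases i
  · exact h0
  · exact h1'
  · exact h2'

theorem eq_zero_of_secondDeriv_eq_fn {y : H2Even T} (h : secondDeriv y = fn y) : y = 0 := by
  refine eq_zero_of_fn_eq_zero (eq_zero_of_second_eq_self (v := y.1 1) y.2.1 ?_)
  rw [← h]
  exact y.2.2.1

theorem integral_cosMode_secondDeriv (y : H2Even T) (n : ℤ) :
    ∫ t, cosMode T n t • secondDeriv y t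
      = -(n * (2 * Real.pi / T)) ^ 2 • ∫ t, cosMode T n t • fn y t :=
  integral_mode_second y.2.1 y.2.2.1 (loopContDiff_cosMode n) (loopDeriv_loopDeriv_cosMode n)

end Even

/-! ### Inverting `d²/dt² - 1` -/

section Inverse

theorem loopDeriv_smul_const {T : ℝ} {φ : AddCircle T → ℝ} (hφ : LoopContDiff (⊤ : ℕ∞) φ) (e : Cell)
    (t : AddCircle T) : loopDeriv (fun t => φ t • e) t = loopDeriv φ t • e := by
  induction t using QuotientAddGroup.induction_on with
  | H t =>
    refine (loopDeriv_coe _ t).trans ?_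
    refine Eq.trans ?_ (congrArg (· • e) (loopDeriv_coe φ t).symm)
    exact deriv_smul_const ((ContDiff.differentiable hφ (by simp)) t) e

theorem isWeakDeriv_smulLoop {φ : AddCircle T → ℝ} (hφ : LoopContDiff (⊤ : ℕ∞) φ) (e : Cell) :
    IsWeakDeriv (toL2 T (smulLoop ⟨φ, hφ.continuous⟩ e))
      (toL2 T (smulLoop ⟨loopDeriv φ, hφ.continuous_loopDeriv (by norm_num)⟩ e)) := by
  have h : LoopContDiff 1 (fun t => φ t • e) :=
    ContDiff.smul (ContDiff.of_le hφ (by norm_cast)) contDiff_const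
  have h1 : toL2 T (smulLoop ⟨loopDeriv φ, hφ.continuous_loopDeriv (by norm_num)⟩ e)
      = contLoop _ (h.continuous_loopDeriv le_rfl) :=
    congrArg (toL2 T) (ContinuousMap.ext fun t => (loopDeriv_smul_const hφ e t).symm :
      _ = (⟨loopDeriv fun t => φ t • e, h.continuous_loopDeriv le_rfl⟩ : C(AddCircle T, Cell)))
  rw [h1]
  exact isWeakDeriv_contLoop _ h

variable (T) in
/-- The Hilbert space `H¹` of periodic functions, recorded as pairs `(u, u')` in `L² × L²`. -/
def H1 : Submodule ℝ (PiLp 2 (fun _ : Fin 2 => L2Loop T)) where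
  carrier := {z | IsWeakDeriv (z 0) (z 1)}
  zero_mem' := IsWeakDeriv.zero
  add_mem' := fun hz hw => hz.add hw
  smul_mem' := fun c _ hz => hz.smul c

instance completeSpace_h1 : CompleteSpace (H1 T) := by
  have h0 : ∀ i : Fin 2, Continuous fun z : PiLp 2 (fun _ : Fin 2 => L2Loop T) => z i :=
    fun i => (PiLp.proj (𝕜 := ℝ) 2 (fun _ : Fin 2 => L2Loop T) i).continuous
  exact IsClosed.completeSpace_coe (hs := isClosed_isWeakDeriv (h0 0) (h0 1))

variable (T) in
/-- The inclusion of `H¹` into `L²`. -/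
def h1Incl : H1 T →L[ℝ] L2Loop T :=
  (PiLp.proj 2 (fun _ : Fin 2 => L2Loop T) (0 : Fin 2)).comp (H1 T).subtypeL

variable (T) in
/-- The weak solution operator of `u - u'' = f`: the adjoint of the inclusion of `H¹` into `L²`,
so that `⟨u, w⟩ + ⟨u', w'⟩ = ⟨f, w⟩` for all `w` in `H¹`. -/
def weakSolve : L2Loop T →L[ℝ] H1 T := ContinuousLinearMap.adjoint (h1Incl T)

/-- Testing the weak equation with the smooth loops `φ • e` shows that `(u')' = u - f`. -/
theorem isWeakDeriv_weakSolve (f : L2Loop T) :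
    IsWeakDeriv ((weakSolve T f).1 1) ((weakSolve T f).1 0 - f) := by
  rw [isWeakDeriv_iff]
  intro φ hφ
  refine ext_inner_left ℝ fun e => ?_
  have h := ContinuousLinearMap.adjoint_inner_right (h1Incl T)
    (⟨WithLp.toLp 2 ![_, _], isWeakDeriv_smulLoop hφ e⟩ : H1 T) f
  change inner ℝ _ ((weakSolve T f).1) = inner ℝ (toL2 T _) f at h
  rw [PiLp.inner_apply, Fin.sum_univ_two] at h
  change inner ℝ (toL2 T _) _ + inner ℝ (toL2 T _) _ = _ at h
  rw [inner_toL2_smulLoop, inner_toL2_smulLoop, inner_toL2_smulLoop, ← pairing_apply,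
    ← pairing_apply, ← pairing_apply] at h
  rw [map_sub, inner_neg_right, inner_sub_right]
  linarith

/-- The solution inherits evenness from the right-hand side, since `u - u(-·)` solves the
homogeneous equation. -/
theorem weakSolve_even {f : L2Loop T} (hf : reflect T f = f) :
    reflect T ((weakSolve T f).1 0) = (weakSolve T f).1 0 := by
  have h1 : IsWeakDeriv ((weakSolve T f).1 0) ((weakSolve T f).1 1) := (weakSolve T f).2
  have h2 := isWeakDeriv_weakSolve f
  have h3 := h1.sub h1.reflect
  have h4 := h2.add h2.reflect
  rw [sub_neg_eq_add] at h3
  have e : (weakSolve T f).1 0 - f + -reflect T ((weakSolve T f).1 0 - f)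
      = (weakSolve T f).1 0 - reflect T ((weakSolve T f).1 0) := by
    rw [map_sub, hf]; abel
  rw [e] at h4
  exact (sub_eq_zero.1 (eq_zero_of_second_eq_self h3 h4)).symm

variable (T) in
/-- The projection of `L²` onto the even functions. -/
def evenPart : L2Loop T →L[ℝ] L2Loop T := (1 / 2 : ℝ) • (ContinuousLinearMap.id ℝ _ + reflect T)

theorem reflect_evenPart (f : L2Loop T) : reflect T (evenPart T f) = evenPart T f := by
  simp [evenPart, reflect_reflect, add_comm]

theorem evenPart_of_even {f : L2Loop T} (hf : reflect T f = f) : evenPart T f = f := by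
  simp only [evenPart, smul_apply, add_apply,
    ContinuousLinearMap.id_apply, hf]
  rw [← two_smul ℝ, smul_smul]
  norm_num

variable (T) in
/-- The map sending `f` to the triple `(y, y', y'')`, where `y` solves `y'' - y = f` for the even
part of `f`. -/
def resolventTriple : L2Loop T →L[ℝ] PiLp 2 (fun _ : Fin 3 => L2Loop T) :=
  ((PiLp.continuousLinearEquiv 2 ℝ (fun _ : Fin 3 => L2Loop T)).symm :
      (Fin 3 → L2Loop T) →L[ℝ] PiLp 2 (fun _ : Fin 3 => L2Loop T)).comp
    (ContinuousLinearMap.pi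
      ![-((PiLp.proj 2 (fun _ : Fin 2 => L2Loop T) (0 : Fin 2)).comp (H1 T).subtypeL ∘L
          weakSolve T ∘L evenPart T),
        -((PiLp.proj 2 (fun _ : Fin 2 => L2Loop T) (1 : Fin 2)).comp (H1 T).subtypeL ∘L
          weakSolve T ∘L evenPart T),
        evenPart T - (PiLp.proj 2 (fun _ : Fin 2 => L2Loop T) (0 : Fin 2)).comp (H1 T).subtypeL ∘L
          weakSolve T ∘L evenPart T])

theorem resolventTriple_zero (f : L2Loop T) :
    resolventTriple T f 0 = -(weakSolve T (evenPart T f)).1 0 := rfl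

theorem resolventTriple_one (f : L2Loop T) :
    resolventTriple T f 1 = -(weakSolve T (evenPart T f)).1 1 := rfl

theorem resolventTriple_two (f : L2Loop T) :
    resolventTriple T f 2 = evenPart T f - (weakSolve T (evenPart T f)).1 0 := rfl

theorem resolventTriple_mem (f : L2Loop T) : resolventTriple T f ∈ H2Even T := by
  have h1 : IsWeakDeriv ((weakSolve T (evenPart T f)).1 0) ((weakSolve T (evenPart T f)).1 1) :=
    (weakSolve T (evenPart T f)).2
  have h2 := isWeakDeriv_weakSolve (evenPart T f)
  refine ⟨?_, ?_, ?_⟩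
  · rw [resolventTriple_zero, resolventTriple_one]
    exact h1.neg
  · rw [resolventTriple_one, resolventTriple_two, ← neg_sub]
    exact h2.neg
  · rw [← reflect_eq_self_iff, resolventTriple_zero, map_neg,
      weakSolve_even (reflect_evenPart f)]

variable (T) in
/-- The inverse of `d²/dt² - 1` on even functions, precomposed with the projection onto the even
functions so as to be defined on all of `L²`. -/
def resolvent : L2Loop T →L[ℝ] H2Even T :=
  (resolventTriple T).codRestrict (H2Even T) resolventTriple_mem

theorem secondDeriv_resolvent_sub {f : L2Loop T} (hf : reflect T f = f) :
    secondDeriv (resolvent T f) - fn (resolvent T f) = f := by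
  change resolventTriple T f 2 - resolventTriple T f 0 = f
  rw [resolventTriple_zero, resolventTriple_two, evenPart_of_even hf]
  abel

theorem resolvent_secondDeriv_sub (y : H2Even T) :
    resolvent T (secondDeriv y - fn y) = y := by
  have h := secondDeriv_resolvent_sub (f := secondDeriv y - fn y)
    (by rw [map_sub, fn_even, secondDeriv_even])
  refine sub_eq_zero.1 (eq_zero_of_secondDeriv_eq_fn ?_)
  simp only [← secondL_apply, ← fnL_apply, map_sub] at h ⊢
  rw [sub_eq_sub_iff_sub_eq_sub]
  exact h

end Inverse

/-! ### The compact embedding of `H²` into the continuous functions -/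

section Embedding

variable (T) in
/-- The `n`-th cosine coefficient of an even `H²` function. -/
def cosCoeff (n : ℤ) : H2Even T →L[ℝ] Cell := T⁻¹ • (pairing (cosMode T n)).comp (fnL T)

/-- The cosine coefficients decay quadratically, since those of the second derivative are
bounded. -/
theorem norm_cosCoeff_le {n : ℤ} (hn : n ≠ 0) :
    ‖cosCoeff T n‖ ≤ T⁻¹ * ((2 * Real.pi / T) ^ 2)⁻¹ * ‖toL2 T‖ * (1 / (n : ℝ) ^ 2) := by
  have hT : 0 < T := Fact.out
  have hn' : (n : ℝ) ≠ 0 := by exact_mod_cast hn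
  have hκ : 0 < ((n : ℝ) * (2 * Real.pi / T)) ^ 2 := by positivity
  refine ContinuousLinearMap.opNorm_le_bound _ (by positivity) fun y => ?_
  have h1 : pairing (cosMode T n) (fn y)
      = -(((n : ℝ) * (2 * Real.pi / T)) ^ 2)⁻¹ • pairing (cosMode T n) (secondDeriv y) := by
    rw [pairing_apply (cosMode T n) (secondDeriv y), integral_cosMode_secondDeriv, smul_smul,
      ← pairing_apply, neg_mul_neg, inv_mul_cancel₀ hκ.ne', one_smul]
  have h2 : ‖pairing (cosMode T n) (secondDeriv y)‖ ≤ ‖toL2 T‖ * ‖y‖ := by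
    refine ((pairing _).le_opNorm _).trans ?_
    gcongr
    · exact (norm_pairing_le _).trans
        (mul_le_of_le_one_right (norm_nonneg (toL2 T)) (norm_cosMode_le n))
    · exact norm_secondDeriv_le y
  change ‖T⁻¹ • pairing (cosMode T n) (fn y)‖ ≤ _
  rw [h1, norm_smul, norm_smul, norm_neg, norm_inv, norm_inv, Real.norm_of_nonneg hT.le,
    Real.norm_of_nonneg hκ.le]
  calc T⁻¹ * ((((n : ℝ) * (2 * Real.pi / T)) ^ 2)⁻¹ * ‖pairing (cosMode T n) (secondDeriv y)‖)
      ≤ T⁻¹ * ((((n : ℝ) * (2 * Real.pi / T)) ^ 2)⁻¹ * (‖toL2 T‖ * ‖y‖)) := by gcongr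
    _ = _ := by rw [mul_pow, mul_inv]; ring

theorem summable_clm_of_norm_le {E F : Type*} [NormedAddCommGroup E] [NormedSpace ℝ E]
    [NormedAddCommGroup F] [NormedSpace ℝ F] [CompleteSpace F] {f : ℤ → E →L[ℝ] F} {b : ℤ → ℝ}
    (hb : Summable b) (h : ∀ n, n ≠ 0 → ‖f n‖ ≤ b n) : Summable f := by
  refine Summable.of_norm_bounded_eventually hb ?_
  filter_upwards [(Set.finite_singleton (0 : ℤ)).compl_mem_cofinite] with n hn using h n hn

/-- The `n`-th term of the cosine series of an even `H²` function. -/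
def cosTerm (n : ℤ) : H2Even T →L[ℝ] C(AddCircle T, Cell) :=
  (smulLoop (cosMode T n)).comp (cosCoeff T n)

theorem norm_cosTerm_le (n : ℤ) (hn : n ≠ 0) : ‖cosTerm (T := T) n‖ ≤
    T⁻¹ * ((2 * Real.pi / T) ^ 2)⁻¹ * ‖toL2 T‖ * (1 / (n : ℝ) ^ 2) :=
  calc ‖cosTerm (T := T) n‖ ≤ ‖smulLoop (cosMode T n)‖ * ‖cosCoeff T n‖ :=
        (smulLoop (cosMode T n)).opNorm_comp_le (cosCoeff T n)
    _ ≤ 1 * ‖cosCoeff T n‖ := by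
        gcongr
        exact (norm_smulLoop_le _).trans (norm_cosMode_le n)
    _ ≤ _ := by
        rw [one_mul]
        exact norm_cosCoeff_le hn

theorem summable_cosTerm : Summable (cosTerm (T := T)) := by
  have h : Summable fun n : ℤ =>
      T⁻¹ * ((2 * Real.pi / T) ^ 2)⁻¹ * ‖toL2 T‖ * (1 / (n : ℝ) ^ 2) :=
    (Real.summable_one_div_int_pow.2 (by norm_num)).mul_left _
  exact summable_clm_of_norm_le h norm_cosTerm_le

variable (T) in
/-- The embedding of `H2Even T` into the continuous functions, given by the cosine series. -/
def contRep : H2Even T →L[ℝ] C(AddCircle T, Cell) := ∑' n : ℤ, cosTerm n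

/-- The embedding is a norm limit of finite-rank operators. -/
theorem isCompactOperator_contRep : IsCompactOperator (contRep T) := by
  refine isCompactOperator_of_tendsto (l := Filter.atTop)
    (F := fun s : Finset ℤ => ∑ n ∈ s, cosTerm (T := T) n) summable_cosTerm.hasSum ?_
  refine Filter.Eventually.of_forall fun s => ?_
  refine (compactOperator (RingHom.id ℝ) (H2Even T) C(AddCircle T, Cell)).sum_mem fun n _ => ?_
  exact (isCompactOperator_of_locallyCompactSpace_rng (smulLoop (cosMode T n))).comp_clm _

theorem hasSum_contRep (y : H2Even T) : HasSum (fun n => cosTerm n y) (contRep T y) :=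
  (summable_cosTerm.hasSum : HasSum (cosTerm (T := T)) (contRep T)).mapL
    (ContinuousLinearMap.apply ℝ C(AddCircle T, Cell) y)

theorem contRep_even (y : H2Even T) (t : AddCircle T) : contRep T y (-t) = contRep T y t := by
  have h := fun t => (ContinuousMap.evalCLM ℝ t).hasSum (hasSum_contRep y)
  refine (h (-t)).unique ?_
  refine (h t).congr_fun fun n => ?_
  change cosMode T n (-t) • cosCoeff T n y = cosMode T n t • cosCoeff T n y
  rw [cosMode_neg]

theorem integral_cos_int (k : ℤ) :
    ∫ t in (0 : ℝ)..T, Real.cos (k * (2 * Real.pi / T) * t) = if k = 0 then T else 0 := by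
  have hT : 0 < T := Fact.out
  split_ifs with hk
  · simp [hk]
  · have hk' : (k : ℝ) * (2 * Real.pi / T) ≠ 0 := by
      have : (k : ℝ) ≠ 0 := by exact_mod_cast hk
      positivity
    rw [intervalIntegral.integral_comp_mul_left _ hk', integral_cos]
    have : (k : ℝ) * (2 * Real.pi / T) * T = k * (2 * Real.pi) := by field_simp
    rw [this, mul_zero, Real.sin_zero]
    have h2 := Real.sin_int_mul_pi (2 * k)
    push_cast at h2
    rw [show (k : ℝ) * (2 * Real.pi) = 2 * k * Real.pi by ring, h2]
    simp

theorem integral_cosMode_mul (m n : ℤ) :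
    ∫ t, cosMode T m t * cosMode T n t
      = (if n = m then T / 2 else 0) + (if n = -m then T / 2 else 0) := by
  rw [← AddCircle.intervalIntegral_preimage T 0, zero_add]
  have e : ∀ t : ℝ, cosMode T m (t : AddCircle T) * cosMode T n (t : AddCircle T)
      = 2⁻¹ * Real.cos ((n - m : ℤ) * (2 * Real.pi / T) * t)
        + 2⁻¹ * Real.cos ((n + m : ℤ) * (2 * Real.pi / T) * t) := by
    intro t
    rw [cosMode_coe, cosMode_coe]
    push_cast
    rw [sub_mul, sub_mul, add_mul, add_mul, Real.cos_sub, Real.cos_add]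
    ring
  simp only [e]
  rw [intervalIntegral.integral_add (Continuous.intervalIntegrable (by fun_prop) _ _)
    (Continuous.intervalIntegrable (by fun_prop) _ _), intervalIntegral.integral_const_mul,
    intervalIntegral.integral_const_mul, integral_cos_int, integral_cos_int]
  simp only [sub_eq_zero, ← eq_neg_iff_add_eq_zero, mul_ite, mul_zero]
  congr 2 <;> ring

theorem pairing_smulLoop (φ ψ : C(AddCircle T, ℝ)) (e : Cell) :
    pairing φ (toL2 T (smulLoop ψ e)) = (∫ t, φ t * ψ t) • e := by
  rw [pairing_apply, ← integral_smul_const]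
  refine integral_congr_ae ?_
  filter_upwards [toL2_ae (smulLoop ψ e)] with t ht
  rw [ht, smulLoop_apply, smul_smul]

theorem reflect_toL2 {f : C(AddCircle T, Cell)} (hf : ∀ t, f (-t) = f t) :
    reflect T (toL2 T f) = toL2 T f := by
  rw [reflect_eq_self_iff]
  filter_upwards [toL2_ae f, ae_neg (toL2_ae f)] with t h1 h2
  rw [h1, h2, hf]

/-- The cosine series of an even `H²` function represents it. -/
theorem toL2_contRep (y : H2Even T) : toL2 T (contRep T y) = fn y := by
  have hT : 0 < T := Fact.out
  refine sub_eq_zero.1 (eq_zero_of_cosModes ?_ fun m => ?_)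
  · rw [map_sub, fn_even, reflect_toL2 (contRep_even y)]
  · rw [← pairing_apply, map_sub, sub_eq_zero]
    have h := ((pairing (cosMode T m)).comp (toL2 T)).hasSum (hasSum_contRep y)
    -- The series runs over `ℤ`, so the modes `m` and `-m` each contribute half of the coefficient;
    -- for `m = 0` the two contributions come from the same term.
    have e : ∀ n, ((pairing (cosMode T m)).comp (toL2 T)) (cosTerm n y)
        = (if n = m then (T / 2) • cosCoeff T n y else 0)
          + (if n = -m then (T / 2) • cosCoeff T n y else 0) := by
      intro n
      change pairing (cosMode T m) (toL2 T (smulLoop (cosMode T n) (cosCoeff T n y))) = _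
      rw [pairing_smulLoop, integral_cosMode_mul, add_smul]
      simp only [ite_smul, zero_smul]
    simp only [e] at h
    have h' := (hasSum_ite_eq m ((T / 2) • cosCoeff T m y)).add
      (hasSum_ite_eq (-m) ((T / 2) • cosCoeff T (-m) y))
    have h'' := h.unique (h'.congr_fun ?_)
    · rw [ContinuousLinearMap.comp_apply] at h''
      rw [h'']
      have e1 : ∀ k, cosCoeff T k y = T⁻¹ • pairing (cosMode T k) (fn y) := fun k => rfl
      rw [e1, e1, cosMode_neg_index, ← add_smul, smul_smul]
      have : (T / 2 + T / 2) * T⁻¹ = 1 := by field_simp; norm_num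
      rw [this, one_smul]
    · intro n
      split_ifs <;> simp_all

theorem contRep_ae (y : H2Even T) : ∀ᵐ t : AddCircle T, fn y t = contRep T y t := by
  have h := toL2_ae (contRep T y)
  rw [toL2_contRep] at h
  exact h

end Embedding

/-! ### The coupling operator -/

section Coupling

variable (T) in
/-- Square-summable sequences of continuous loops. -/
abbrev LoopSeq : Type := lp (fun _ : ℤ => C(AddCircle T, Cell)) 2

theorem norm_evalCLM_le (t : AddCircle T) :
    ‖(ContinuousMap.evalCLM ℝ t : C(AddCircle T, Cell) →L[ℝ] Cell)‖ ≤ 1 :=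
  ContinuousLinearMap.opNorm_le_bound _ zero_le_one fun f => by
    rw [one_mul]; exact f.norm_coe_le_norm t

/-- The configuration of a sequence of continuous loops at time `t`. -/
def configAt (t : AddCircle T) : LoopSeq T →L[ℝ] Config :=
  lp.mapCLM 2 (fun _ : ℤ => ContinuousMap.evalCLM ℝ t) zero_le_one fun _ => norm_evalCLM_le t

@[simp]
theorem configAt_apply (t : AddCircle T) (Y : LoopSeq T) (n : ℤ) : configAt t Y n = Y n t := rfl

theorem norm_configAt_le (t : AddCircle T) (Y : LoopSeq T) : ‖configAt t Y‖ ≤ ‖Y‖ := by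
  refine ((configAt t).le_opNorm Y).trans (mul_le_of_le_one_left (norm_nonneg Y) ?_)
  exact lp.norm_mapCLM_le _ _ _ _

theorem configAt_single (t : AddCircle T) (n : ℤ) (f : C(AddCircle T, Cell)) :
    configAt t (lp.single 2 n f) = lp.single 2 n (f t) := by
  ext m : 2
  change (lp.single 2 n f : LoopSeq T) m t = (lp.single 2 n (f t) : Config) m
  by_cases h : m = n
  · subst h; simp
  · rw [lp.single_apply_ne _ _ _ h, lp.single_apply_ne _ _ _ h]; rfl

/-- A square-summable sequence of loops is a continuous loop in the space of configurations: the
finite truncations converge uniformly in time. -/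
theorem continuous_configAt (Y : LoopSeq T) : Continuous fun t => configAt t Y := by
  have hY := lp.hasSum_single (by norm_num) Y
  have hu : TendstoUniformly
      (fun (s : Finset ℤ) (t : AddCircle T) => configAt t (∑ n ∈ s, lp.single 2 n (Y n)))
      (fun t => configAt t Y) Filter.atTop := by
    refine Metric.tendstoUniformly_iff.2 fun ε hε => ?_
    filter_upwards [Metric.tendsto_nhds.1 hY ε hε] with s hs t
    rw [dist_eq_norm, ← map_sub]
    rw [dist_comm, dist_eq_norm] at hs
    exact (norm_configAt_le _ _).trans_lt hs
  refine hu.continuous (Filter.Eventually.frequently (Filter.Eventually.of_forall fun s => ?_))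
  simp only [map_sum, configAt_single]
  refine continuous_finsetSum _ fun n _ => ?_
  exact (lp.isometry_single n).continuous.comp (Y n).continuous

/-- The `n`-th component of `t ↦ R (Y(t))`. -/
def couplingLoop (R : Config →L[ℝ] Config) (Y : LoopSeq T) (n : ℤ) : C(AddCircle T, Cell) :=
  ⟨fun t => R (configAt t Y) n,
    (lp.evalCLM ℝ (fun _ : ℤ => Cell) 2 n).continuous.comp
      (R.continuous.comp (continuous_configAt Y))⟩

@[simp]
theorem couplingLoop_apply (R : Config →L[ℝ] Config) (Y : LoopSeq T) (n : ℤ) (t : AddCircle T) :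
    couplingLoop R Y n t = R (configAt t Y) n := rfl

theorem norm_toL2_sq (f : C(AddCircle T, Cell)) : ‖toL2 T f‖ ^ 2 = ∫ t, ‖f t‖ ^ 2 := by
  rw [← real_inner_self_eq_norm_sq, L2.inner_def]
  refine integral_congr_ae ?_
  filter_upwards [toL2_ae f] with t ht
  rw [ht, real_inner_self_eq_norm_sq]

/-- Boundedness of the coupling: at each time the sum over the sites is at most
`‖R‖² ‖Y(t)‖² ≤ ‖R‖² ‖Y‖²`, and the period is finite. -/
theorem sum_norm_couplingLoop_le (R : Config →L[ℝ] Config) (Y : LoopSeq T) (s : Finset ℤ) :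
    ∑ n ∈ s, ‖toL2 T (couplingLoop R Y n)‖ ^ (2 : ℝ≥0∞).toReal
      ≤ (Real.sqrt T * ‖R‖ * ‖Y‖) ^ (2 : ℝ≥0∞).toReal := by
  have hT : 0 < T := Fact.out
  simp only [ENNReal.toReal_ofNat, Real.rpow_ofNat, norm_toL2_sq]
  have hi : ∀ n : ℤ, Integrable (fun t => ‖couplingLoop R Y n t‖ ^ 2)
      (volume : Measure (AddCircle T)) :=
    fun n => ((couplingLoop R Y n).continuous.norm.pow 2).integrable_of_hasCompactSupport
      (HasCompactSupport.of_compactSpace _)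
  rw [← integral_finsetSum _ fun n _ => hi n]
  calc ∫ t, ∑ n ∈ s, ‖couplingLoop R Y n t‖ ^ 2
      ≤ ∫ _ : AddCircle T, (‖R‖ * ‖Y‖) ^ 2 := by
        refine integral_mono (integrable_finsetSum _ fun n _ => hi n) (integrable_const _)
          fun t => ?_
        have h1 := lp.sum_rpow_le_norm_rpow (p := 2) (by norm_num) (R (configAt t Y)) s
        simp only [ENNReal.toReal_ofNat, Real.rpow_ofNat] at h1
        refine h1.trans ?_
        gcongr
        exact (R.le_opNorm _).trans (by gcongr; exact norm_configAt_le t Y)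
    _ = (Real.sqrt T * ‖R‖ * ‖Y‖) ^ 2 := by
        rw [integral_const, mul_assoc, mul_pow (Real.sqrt T), Real.sq_sqrt hT.le, measureReal_def,
          AddCircle.measure_univ, ENNReal.toReal_ofReal hT.le, smul_eq_mul]

/-- The operator `R`, applied at each time, as a bounded operator from square-summable sequences
of continuous loops to square-summable sequences in `L²`. -/
def coupling (R : Config →L[ℝ] Config) : LoopSeq T →L[ℝ] lp (fun _ : ℤ => L2Loop T) 2 :=
  LinearMap.mkContinuous
    { toFun := fun Y => ⟨fun n => toL2 T (couplingLoop R Y n),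
        memℓp_gen' (sum_norm_couplingLoop_le R Y)⟩
      map_add' := fun Y Z => by
        ext n : 2
        change toL2 T (couplingLoop R (Y + Z) n)
          = toL2 T (couplingLoop R Y n) + toL2 T (couplingLoop R Z n)
        rw [← map_add]
        congr 1
        ext t : 1
        simp
      map_smul' := fun c Y => by
        ext n : 2
        change toL2 T (couplingLoop R (c • Y) n) = c • toL2 T (couplingLoop R Y n)
        rw [← map_smul]
        congr 1
        ext t : 1
        simp } (Real.sqrt T * ‖R‖)
    fun Y => lp.norm_le_of_forall_sum_le (by norm_num) (by positivity)
      (sum_norm_couplingLoop_le R Y)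

variable (T) in
/-- The continuous representatives of the components of a sequence of `H²` functions. -/
def contRepSeq : BreatherSpace T →L[ℝ] LoopSeq T :=
  lp.mapCLM 2 (fun _ : ℤ => contRep T) (norm_nonneg (contRep T)) fun _ => le_rfl

@[simp]
theorem contRepSeq_apply (X : BreatherSpace T) (n : ℤ) :
    contRepSeq T X n = contRep T (X n) := rfl

theorem snapshot_eq_configAt_ae (X : BreatherSpace T) :
    ∀ᵐ t : AddCircle T, snapshot X t = configAt t (contRepSeq T X) := by
  filter_upwards [snapshot_ae X, ae_all_iff.2 fun n => contRep_ae (X n)] with t h1 h2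
  ext n : 2
  rw [h1, h2]
  rfl

theorem couplingLoop_even (R : Config →L[ℝ] Config) (X : BreatherSpace T) (n : ℤ)
    (t : AddCircle T) :
    couplingLoop R (contRepSeq T X) n (-t) = couplingLoop R (contRepSeq T X) n t := by
  have h : configAt (-t) (contRepSeq T X) = configAt t (contRepSeq T X) := by
    ext m : 2
    exact contRep_even (X m) t
  rw [couplingLoop_apply, h, couplingLoop_apply]

end Coupling

/-! ### The on-site nonlinearity -/

section Onsite

variable {V : ℝ → ℝ} {γ : ℝ}

theorem contDiff_onsite (hV : ContDiff ℝ 2 V) (γ : ℝ) : ContDiff ℝ 1 (onsite V γ) := by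
  have hV' : ContDiff ℝ 1 (deriv V) :=
    (contDiff_succ_iff_deriv.1 (by simpa [one_add_one_eq_two] using hV)).2.2
  rw [contDiff_euclidean]
  intro j
  fin_cases j
  · change ContDiff ℝ 1 fun x : Cell => deriv V (x 0) - γ * x 1
    fun_prop
  · change ContDiff ℝ 1 fun x : Cell => deriv V (x 1) - γ * x 0
    fun_prop

theorem onsite_zero (hVeven : ∀ x, V (-x) = V x) (γ : ℝ) : onsite V γ 0 = 0 := by
  have h : deriv V 0 = 0 := by
    have h1 := deriv_comp_neg V 0
    simp only [hVeven, neg_zero] at h1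
    linarith
  ext j
  fin_cases j <;> simp [onsite, h]

theorem fderiv_onsite (hV : ContDiff ℝ 2 V) (γ : ℝ) (a y : Cell) :
    fderiv ℝ (onsite V γ) a y = onsiteLin V γ a y := by
  have hV' : ContDiff ℝ 1 (deriv V) :=
    (contDiff_succ_iff_deriv.1 (by simpa [one_add_one_eq_two] using hV)).2.2
  have hd : Differentiable ℝ (deriv V) := hV'.differentiable (by norm_num)
  have h := ((contDiff_onsite hV γ).differentiable (by norm_num) a).hasFDerivAt
  have h' := fun j : Fin 2 => (EuclideanSpace.proj j : Cell →L[ℝ] ℝ).hasFDerivAt.comp a h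
  have p : ∀ j : Fin 2, HasFDerivAt (fun x : Cell => x j)
      (EuclideanSpace.proj j : Cell →L[ℝ] ℝ) a :=
    fun j => (EuclideanSpace.proj j : Cell →L[ℝ] ℝ).hasFDerivAt
  have q : ∀ i j : Fin 2, HasFDerivAt (fun x : Cell => deriv V (x i) - γ * x j)
      (deriv (deriv V) (a i) • (EuclideanSpace.proj i : Cell →L[ℝ] ℝ)
        - γ • (EuclideanSpace.proj j : Cell →L[ℝ] ℝ)) a := by
    intro i j
    have h1 : HasDerivAt (deriv V) (deriv (deriv V) (a i)) (a i) := (hd (a i)).hasDerivAt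
    exact (h1.comp_hasFDerivAt a (p i)).fun_sub ((p j).const_mul γ)
  ext j
  fin_cases j
  · exact congrArg (fun L : Cell →L[ℝ] ℝ => L y) ((h' 0).unique (q 0 1))
  · exact congrArg (fun L : Cell →L[ℝ] ℝ => L y) ((h' 1).unique (q 1 0))

end Onsite

/-! ### The equation as a fixed-point problem -/

section Equation

variable (T) in
/-- Componentwise inclusion of continuous loops into `L²`. -/
def toL2Seq : LoopSeq T →L[ℝ] lp (fun _ : ℤ => L2Loop T) 2 :=
  lp.mapCLM 2 (fun _ : ℤ => toL2 T) (norm_nonneg (toL2 T)) fun _ => le_rfl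

variable (T) in
/-- Componentwise inverse of `d²/dt² - 1`. -/
def resolventSeq : lp (fun _ : ℤ => L2Loop T) 2 →L[ℝ] BreatherSpace T :=
  lp.mapCLM 2 (fun _ : ℤ => resolvent T) (norm_nonneg (resolvent T)) fun _ => le_rfl

variable {g : Cell → Cell}

/-- The equation `ẍₙ + g(xₙ) + s [R x]ₙ = 0`, multiplied by the inverse of `d²/dt² - 1`. -/
def preconditioned (hg : ContDiff ℝ 1 g) (h0 : g 0 = 0) (R : Config →L[ℝ] Config)
    (p : ℝ × BreatherSpace T) : BreatherSpace T :=
  p.2 + resolventSeq T (toL2Seq T (superposition hg h0 (contRepSeq T p.2) + contRepSeq T p.2)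
    + p.1 • coupling R (contRepSeq T p.2))

/-- The function to which the inverse of `d²/dt² - 1` is applied at the `n`-th site. -/
def siteForce (hg : ContDiff ℝ 1 g) (h0 : g 0 = 0) (R : Config →L[ℝ] Config) (s : ℝ)
    (X : BreatherSpace T) (n : ℤ) : C(AddCircle T, Cell) :=
  superposition hg h0 (contRepSeq T X) n + contRepSeq T X n
    + s • couplingLoop R (contRepSeq T X) n

theorem siteForce_apply (hg : ContDiff ℝ 1 g) (h0 : g 0 = 0) (R : Config →L[ℝ] Config) (s : ℝ)
    (X : BreatherSpace T) (n : ℤ) (t : AddCircle T) :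
    siteForce hg h0 R s X n t = g (contRep T (X n) t) + contRep T (X n) t
      + s • R (configAt t (contRepSeq T X)) n := rfl

theorem preconditioned_apply (hg : ContDiff ℝ 1 g) (h0 : g 0 = 0) (R : Config →L[ℝ] Config)
    (s : ℝ) (X : BreatherSpace T) (n : ℤ) :
    preconditioned hg h0 R (s, X) n
      = X n + resolvent T (toL2 T (siteForce hg h0 R s X n)) := by
  rw [siteForce, map_add, map_smul]
  rfl

theorem siteForce_even (hg : ContDiff ℝ 1 g) (h0 : g 0 = 0) (R : Config →L[ℝ] Config)
    (s : ℝ) (X : BreatherSpace T) (n : ℤ) (t : AddCircle T) :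
    siteForce hg h0 R s X n (-t) = siteForce hg h0 R s X n t := by
  have h := couplingLoop_even R X n t
  rw [couplingLoop_apply, couplingLoop_apply] at h
  rw [siteForce_apply, siteForce_apply, contRep_even, h]

/-- If `y + (d²/dt² - 1)⁻¹ f = 0` with `f` even then `y'' + f = y`. -/
theorem secondDeriv_add_of_add_resolvent {y : H2Even T} {f : C(AddCircle T, Cell)}
    (hf : ∀ t, f (-t) = f t) (h : y + resolvent T (toL2 T f) = 0) :
    ∀ᵐ t : AddCircle T, secondDeriv y t + f t = contRep T y t := by
  have h1 := secondDeriv_resolvent_sub (reflect_toL2 hf)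
  have h2 : secondDeriv y + toL2 T f = fn y := by
    rw [eq_neg_of_add_eq_zero_right h] at h1
    rw [← h1]
    simp only [← secondL_apply, ← fnL_apply, map_neg]
    abel
  filter_upwards [Lp.coeFn_add (secondDeriv y) (toL2 T f), toL2_ae f, contRep_ae y]
    with t h3 h4 h5
  rw [← h5, ← h2, h3, Pi.add_apply, h4]

/-- Zeros of `preconditioned` solve the equations of motion. -/
theorem arrayMap_eq_zero_of_preconditioned {V : ℝ → ℝ} {γ : ℝ}
    (hg : ContDiff ℝ 1 (onsite V γ)) (h0 : onsite V γ 0 = 0) (R : Config →L[ℝ] Config) {s : ℝ}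
    {X : BreatherSpace T} (h : preconditioned hg h0 R (s, X) = 0) (n : ℤ) :
    ∀ᵐ t : AddCircle T, arrayMap V γ R X s n t = 0 := by
  have hn : X n + resolvent T (toL2 T (siteForce hg h0 R s X n)) = 0 := by
    rw [← preconditioned_apply, h]; rfl
  filter_upwards [secondDeriv_add_of_add_resolvent (siteForce_even hg h0 R s X n) hn,
    snapshot_eq_configAt_ae X, contRep_ae (X n)] with t h1 h2 h3
  rw [siteForce_apply] at h1
  rw [arrayMap, h2, h3]
  rw [← sub_eq_zero] at h1
  rw [← h1]
  abel

theorem contDiff_preconditioned (hg : ContDiff ℝ 1 g) (h0 : g 0 = 0) (R : Config →L[ℝ] Config) :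
    ContDiff ℝ 1 (preconditioned (T := T) hg h0 R) := by
  have h1 : ContDiff ℝ 1 fun p : ℝ × BreatherSpace T => contRepSeq T p.2 :=
    (contRepSeq T).contDiff.comp contDiff_snd
  have h2 := (contDiff_superposition (ι := ℤ) (K := AddCircle T) hg h0).comp h1
  exact contDiff_snd.add ((resolventSeq T).contDiff.comp
    (((toL2Seq T).contDiff.comp (h2.add h1)).add
      (contDiff_fst.smul ((coupling R).contDiff.comp h1))))

/-- The linearization of `preconditioned` at one site, along the loop `x`: it is
`(d²/dt² - 1)⁻¹ (d²/dt² + g'(x(t)))`. -/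
def siteLin (hg : ContDiff ℝ 1 g) (x : C(AddCircle T, Cell)) : H2Even T →L[ℝ] H2Even T :=
  ContinuousLinearMap.id ℝ _ + resolvent T ∘L toL2 T ∘L
    (applyFamily (fderivAlong hg x) + ContinuousLinearMap.id ℝ _) ∘L contRep T

theorem exists_equiv_siteLin (hg : ContDiff ℝ 1 g) {x : C(AddCircle T, Cell)}
    (hx : ∀ t, x (-t) = x t)
    (hinj : ∀ y : H2Even T,
      (∀ᵐ t : AddCircle T, secondDeriv y t + fderiv ℝ g (x t) (fn y t) = 0) → y = 0) :
    ∃ e : H2Even T ≃L[ℝ] H2Even T, siteLin hg x = e := by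
  have hK : IsCompactOperator ((resolvent T ∘L toL2 T ∘L
      (applyFamily (fderivAlong hg x) + ContinuousLinearMap.id ℝ _)) ∘L contRep T) :=
    isCompactOperator_contRep.clm_comp (resolvent T ∘L toL2 T ∘L
      (applyFamily (fderivAlong hg x) + ContinuousLinearMap.id ℝ _))
  obtain ⟨e, he⟩ := exists_equiv_of_isCompactOperator hK <| by
    intro y hy
    have hy' : y + resolvent T (toL2 T (applyFamily (fderivAlong hg x) (contRep T y)
        + contRep T y)) = 0 := hy
    have hev : ∀ t, (applyFamily (fderivAlong hg x) (contRep T y) + contRep T y) (-t)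
        = (applyFamily (fderivAlong hg x) (contRep T y) + contRep T y) t := fun t => by
      change fderiv ℝ g (x (-t)) (contRep T y (-t)) + contRep T y (-t)
        = fderiv ℝ g (x t) (contRep T y t) + contRep T y t
      rw [hx, contRep_even]
    refine hinj y ?_
    filter_upwards [secondDeriv_add_of_add_resolvent hev hy', contRep_ae y] with t h1 h2
    rw [h2]
    change secondDeriv y t + (fderiv ℝ g (x t) (contRep T y t) + contRep T y t) = _ at h1
    rwa [← add_assoc, add_eq_right] at h1
  exact ⟨e, ContinuousLinearMap.ext fun y => (he y).symm⟩

/-- The derivative of `preconditioned` in the direction of the configuration, at a configuration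
with one excited site, is invertible as soon as the linearizations along the excited loop and
along `0` are. -/
theorem exists_hasFDerivAt_preconditioned (hg : ContDiff ℝ 1 g) (h0 : g 0 = 0)
    (R : Config →L[ℝ] Config) (z : H2Even T) {e₀ e : H2Even T ≃L[ℝ] H2Even T}
    (he₀ : siteLin hg (contRep T z) = e₀) (he : siteLin hg (0 : C(AddCircle T, Cell)) = e) :
    ∃ f' : ℝ × BreatherSpace T →L[ℝ] BreatherSpace T,
      HasFDerivAt (preconditioned hg h0 R) f' (0, lp.single 2 0 z) ∧
      (f' ∘L .inr ℝ ℝ (BreatherSpace T)).IsInvertible := by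
  set X : BreatherSpace T := lp.single 2 0 z with hX
  have h1 : HasFDerivAt (fun p : ℝ × BreatherSpace T => contRepSeq T p.2)
      (contRepSeq T ∘L .snd ℝ ℝ (BreatherSpace T)) ((0 : ℝ), X) :=
    (contRepSeq T).hasFDerivAt.comp _ hasFDerivAt_snd
  have h2 := (hasFDerivAt_superposition hg h0 (contRepSeq T X)).comp ((0 : ℝ), X) h1
  have h3 := hasFDerivAt_snd.add ((resolventSeq T).hasFDerivAt.comp ((0 : ℝ), X)
    (((toL2Seq T).hasFDerivAt.comp ((0 : ℝ), X) (h2.add h1)).add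
      (hasFDerivAt_fst.smul ((coupling R).hasFDerivAt.comp ((0 : ℝ), X) h1))))
  refine ⟨_, h3, ?_⟩
  -- The derivative acts diagonally, with only two distinct entries, so that uniform bounds are
  -- available for the entries and for their inverses.
  set A : ℤ → H2Even T →L[ℝ] H2Even T := fun n => if n = 0 then e₀ else e with hA
  have hAn : ∀ n, A n = siteLin hg (contRepSeq T X n) := by
    intro n
    rw [contRepSeq_apply]
    by_cases hn : n = 0
    · subst hn; simp [hA, hX, he₀]
    · simp [hA, hX, hn, ← he]
  have hb : ∀ n, ‖A n‖ ≤ max ‖(e₀ : H2Even T →L[ℝ] H2Even T)‖ ‖(e : H2Even T →L[ℝ] H2Even T)‖ := by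
    intro n
    by_cases hn : n = 0
    · simp only [hA, hn, if_true]; exact le_max_left _ _
    · simp only [hA, hn, if_false]; exact le_max_right _ _
  have hinv := isInvertible_mapCLM (fun n => if n = 0 then e₀ else e) A
    (fun n => by by_cases hn : n = 0 <;> simp [hA, hn]) (by positivity) hb
    (C' := max ‖(e₀.symm : H2Even T →L[ℝ] H2Even T)‖ ‖(e.symm : H2Even T →L[ℝ] H2Even T)‖)
    (by positivity) fun n => by
      by_cases hn : n = 0
      · simp only [hn, if_true]; exact le_max_left _ _
      · simp only [hn, if_false]; exact le_max_right _ _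
  convert! hinv using 1
  refine ContinuousLinearMap.ext fun Y => ?_
  ext n : 2
  change _ = A n (Y n)
  rw [hAn, contRepSeq_apply]
  -- The coupling enters with the factor `0`, both through `s = 0` and through the increment of `s`.
  change Y n + resolvent T (toL2 T (applyFamily (fderivAlong hg (contRep T (X n)))
      (contRep T (Y n)) + contRep T (Y n)) + ((0 : ℝ) • toL2 T (couplingLoop R (contRepSeq T Y) n)
        + (0 : ℝ) • toL2 T (couplingLoop R (contRepSeq T X) n)))
    = Y n + resolvent T (toL2 T (applyFamily (fderivAlong hg (contRep T (X n)))
      (contRep T (Y n)) + contRep T (Y n)))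
  rw [zero_smul, zero_smul, add_zero, add_zero]

end Equation

/-! ### The excited and the resting sites -/

section Sites

variable {V : ℝ → ℝ} {γ : ℝ}

theorem fn_classicalLoop_ae {x : AddCircle T → Cell} (hx : LoopContDiff 2 x)
    (hev : ∀ t, x (-t) = x t) : ∀ᵐ t : AddCircle T, fn (classicalLoop x hx hev) t = x t :=
  contLoop_ae x hx.continuous

/-- At a site at rest the linearization is injective, by non-resonance: its cosine coefficients
decouple into the in-phase and the out-of-phase modes. -/
theorem eq_zero_of_nonresonance (hV : ContDiff ℝ 2 V)
    (nonresonance : ∀ n : ℤ,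
      ((n : ℝ) * (2 * Real.pi / T)) ^ 2 ≠ deriv (deriv V) 0 + γ ∧
      ((n : ℝ) * (2 * Real.pi / T)) ^ 2 ≠ deriv (deriv V) 0 - γ) (y : H2Even T)
    (hy : ∀ᵐ t : AddCircle T, secondDeriv y t + fderiv ℝ (onsite V γ) 0 (fn y t) = 0) :
    y = 0 := by
  refine eq_zero_of_fn_eq_zero (eq_zero_of_cosModes (fn_even y) fun n => ?_)
  obtain ⟨hp, hm⟩ := nonresonance n
  set c := ∫ t, cosMode T n t • fn y t with hc
  have h1 := integral_cosMode_secondDeriv y n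
  have h2 : ∫ t, cosMode T n t • secondDeriv y t
      = ∫ t, -fderiv ℝ (onsite V γ) 0 (cosMode T n t • fn y t) := by
    refine integral_congr_ae ?_
    filter_upwards [hy] with t ht
    rw [map_smul, ← smul_neg, eq_neg_of_add_eq_zero_left ht]
  rw [integral_neg, (fderiv ℝ (onsite V γ) 0).integral_comp_comm
    (integrable_smul_L2Loop (cosMode T n).continuous (fn y)), h1, ← hc, fderiv_onsite hV] at h2
  have e0 := congrArg (fun v : Cell => v 0) h2
  have e1 := congrArg (fun v : Cell => v 1) h2
  simp only [onsiteLin, PiLp.smul_apply, PiLp.neg_apply, smul_eq_mul, Matrix.cons_val_zero,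
    Matrix.cons_val_one, PiLp.zero_apply] at e0 e1
  have hs : (deriv (deriv V) 0 - γ - (n * (2 * Real.pi / T)) ^ 2) * (c 0 + c 1) = 0 := by
    linear_combination e0 + e1
  have hd : (deriv (deriv V) 0 + γ - (n * (2 * Real.pi / T)) ^ 2) * (c 0 - c 1) = 0 := by
    linear_combination e0 - e1
  have hs' := (mul_eq_zero.1 hs).resolve_left (sub_ne_zero.2 hm.symm)
  have hd' := (mul_eq_zero.1 hd).resolve_left (sub_ne_zero.2 hp.symm)
  ext j
  fin_cases j
  · change c 0 = 0
    linarith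
  · change c 1 = 0
    linarith

/-- `X_*` solves the uncoupled equation: at the excited site by the equation for `x`, and at the
other sites because the on-site force vanishes at the origin. -/
theorem preconditioned_seed {x : AddCircle T → Cell} (hx : IsDimerOrbit V γ x)
    (hg : ContDiff ℝ 1 (onsite V γ)) (h0 : onsite V γ 0 = 0) (R : Config →L[ℝ] Config) :
    preconditioned hg h0 R (0, seed hx) = 0 := by
  ext n : 2
  rw [preconditioned_apply]
  change _ = (0 : H2Even T)
  by_cases hn : n = 0
  · subst hn
    have hz : seed hx 0 = classicalLoop x hx.contDiff hx.even := lp.single_apply_self _ _ _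
    rw [hz]
    set z := classicalLoop x hx.contDiff hx.even with hzdef
    have hf : toL2 T (siteForce hg h0 R 0 (seed hx) 0) = -(secondDeriv z - fn z) := by
      refine Lp.ext ?_
      have h2 : ∀ᵐ t : AddCircle T, secondDeriv z t = loopDeriv (loopDeriv x) t :=
        contLoop_ae _ (hx.contDiff.loopDeriv_succ.continuous_loopDeriv le_rfl)
      filter_upwards [toL2_ae (siteForce hg h0 R 0 (seed hx) 0), contRep_ae z, h2,
        fn_classicalLoop_ae hx.contDiff hx.even, Lp.coeFn_neg (secondDeriv z - fn z),
        Lp.coeFn_sub (secondDeriv z) (fn z)] with t h3 h4 h5 h6 h7 h8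
      rw [h3, h7, Pi.neg_apply, h8, Pi.sub_apply, siteForce_apply, hz, ← h4, h5, h6,
        zero_smul, add_zero, eq_neg_of_add_eq_zero_left (hx.eq t)]
      abel
    rw [hf, map_neg, resolvent_secondDeriv_sub, add_neg_cancel]
  · have hz : seed hx n = 0 := lp.single_apply_ne _ _ _ hn
    have hf : siteForce hg h0 R 0 (seed hx) n = 0 := by
      ext t : 1
      rw [siteForce_apply, hz, map_zero, zero_smul]
      simp [h0]
    rw [hz, hf, map_zero, map_zero, add_zero]

end Sites

end DimerArray

end

theorem theorem2p1
    (V : ℝ → ℝ) (hV : ContDiff ℝ 2 V) (hVeven : ∀ x, V (-x) = V x)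
    (γ : ℝ) (R : DimerArray.Config →L[ℝ] DimerArray.Config)
    (T : ℝ) [Fact (0 < T)]
    (x : AddCircle T → DimerArray.Cell) (hx : DimerArray.IsDimerOrbit V γ x)
    (nonresonance : ∀ n : ℤ,
      ((n : ℝ) * (2 * Real.pi / T)) ^ 2 ≠ deriv (deriv V) 0 + γ ∧
      ((n : ℝ) * (2 * Real.pi / T)) ^ 2 ≠ deriv (deriv V) 0 - γ)
    (nondegeneracy : ∀ y : DimerArray.H2Even T,
      (∀ᵐ t : AddCircle T, DimerArray.linearizedDimer V γ x y t = 0) → y = 0) :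
    ∃ lam_b : ℝ, 0 < lam_b ∧ ∃ X : ℝ → DimerArray.BreatherSpace T,
      ContDiffOn ℝ 1 X (Set.Ico 0 lam_b) ∧
      X 0 = DimerArray.seed hx ∧
      ∀ lam ∈ Set.Ico 0 lam_b, ∀ n : ℤ, ∀ᵐ t : AddCircle T,
        DimerArray.arrayMap V γ R (X lam) lam n t = 0 := by
  have hg := DimerArray.contDiff_onsite hV γ
  have h0 := DimerArray.onsite_zero hVeven γ
  set z := DimerArray.classicalLoop x hx.contDiff hx.even with hz
  obtain ⟨e₀, he₀⟩ := DimerArray.exists_equiv_siteLin hg (x := DimerArray.contRep T z)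
    (DimerArray.contRep_even z) fun y hy => nondegeneracy y <| by
      filter_upwards [hy, DimerArray.contRep_ae z,
        DimerArray.fn_classicalLoop_ae hx.contDiff hx.even] with t h1 h2 h3
      rwa [← h2, h3, DimerArray.fderiv_onsite hV] at h1
  obtain ⟨e, he⟩ := DimerArray.exists_equiv_siteLin hg (x := (0 : C(AddCircle T, DimerArray.Cell)))
    (fun _ => rfl) (DimerArray.eq_zero_of_nonresonance hV nonresonance)
  obtain ⟨f', hf', hinv⟩ := DimerArray.exists_hasFDerivAt_preconditioned hg h0 R z he₀ he
  obtain ⟨r, hr, X, hX, hX0, hXs⟩ := DimerArray.exists_curve_of_contDiff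
    (DimerArray.contDiff_preconditioned hg h0 R) (DimerArray.preconditioned_seed hx hg h0 R)
    hf' hinv
  exact ⟨r, hr, X, hX, hX0, fun s hs n =>
    DimerArray.arrayMap_eq_zero_of_preconditioned hg h0 R (hXs s hs) n⟩
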